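/- **Theorem (exterior extension).** Conventions. All functions are real valued. Let $0<\alpha<1$, $1\le p<\infty$. For $\varphi\in C_0^\infty(\mathbb R)$ let $${}^{-}D^{\alpha}\varphi(x)=\frac{1}{\Gamma(1-\alpha)}\frac{d}{dx}\int_{-\infty}^x\frac{\varphi(y)}{(x-y)^{\alpha}}\,dy,\qquad {}^{+}D^{\alpha}\varphi(x)=-\frac{1}{\Gamma(1-\alpha)}\frac{d}{dx}\int_x^{\infty}\frac{\varphi(y)}{(y-x)^{\alpha}}\,dy$$ be the left and right Riemann–Liouville derivatives. Let $\Omega$ be a bounded open interval or $\mathbb R$. A function $v\in L^1_{loc}(\Omega)$ is the left (right) weak fractional derivative ${}^{\mp}\mathcal D^{\alpha}u$ of $u\in L^1(\Omega)$ (upper sign: left) if $\int_\Omega v\varphi\,dx=\int_\Omega u\;{}^{\pm}D^{\alpha}\tilde\varphi\,dx$ for all $\varphi\in C_0^\infty(\Omega)$, where $\tilde\varphi$ is the extension of $\varphi$ by zero. Put $${}^{\pm}W^{\alpha,p}(\Omega)=\{u\in L^1(\Omega)\cap L^p(\Omega):{}^{\pm}\mathcal D^{\alpha}u\text{ exists and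 lies in }L^p(\Omega)\},\qquad \|u\|_{{}^{\pm}W^{\alpha,p}(\Omega)}=\bigl(\|u\|_{L^p(\Omega)}^p+\|{}^{\pm}\mathcal D^{\alpha}u\|_{L^p(\Omega)}^p\bigr)^{1/p}.$$ Statement. Let $0<\alpha<1$ and $1\le p<\infty$ with $\alpha p<1$, and let $\Omega'\subset\mathbb R$ be a bounded domain. Then there is a constant $C=C(\alpha,p,\Omega')>0$ such that for every interval $\Omega=(a,b)$, $a<b$, with $\overline\Omega\subset\Omega'$, every real $\mu>p/(1-\alpha p)$, and each of the two signs, there is a mapping $E_\pm:{}^{\pm}W^{\alpha,p}(\Omega)\cap L^\mu(\Omega)\to{}^{\pm}W^{\alpha,p}(\mathbb R)$ such that for every $u\in{}^{\pm}W^{\alpha,p}(\Omega)\cap L^\mu(\Omega)$: 1. $E_\pm u=u$ a.e. in $\Omega$; 2. the (essential) support of $E_\pm u$ is a compact subset of $\Omega'$; 3. $\|E_\pm u\|_{{}^{\pm}W^{\alpha,p}(\mathbb R)}\le C\bigl(\|u\|_{{}^{\pm}W^{\alpha,p}(\Omega)}+\|u\|_{L^\mu(\Omega)}\bigr)$. 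-/

import Mathlib

open MeasureTheory Set

open scoped ContDiff ENNReal

noncomputable section

/-- The two directions of one-sided fractional calculus: `left` is written with the superscript
`-` and `right` with the superscript `+`. -/
inductive Side : Type
  | left : Side
  | right : Side

/-- The left Riemann-Liouville derivative on the line, of order `0 < α < 1`:
`(1 / Γ(1 - α)) d/dx ∫_{-∞}^x φ(y) (x - y)^(-α) dy`. -/
def leftRLDeriv (α : ℝ) (φ : ℝ → ℝ) (x : ℝ) : ℝ :=
  (Real.Gamma (1 - α))⁻¹ * deriv (fun t => ∫ y in Iio t, φ y * (t - y) ^ (-α)) x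

/-- The right Riemann-Liouville derivative on the line, of order `0 < α < 1`:
`-(1 / Γ(1 - α)) d/dx ∫_x^∞ φ(y) (y - x)^(-α) dy`. -/
def rightRLDeriv (α : ℝ) (φ : ℝ → ℝ) (x : ℝ) : ℝ :=
  -((Real.Gamma (1 - α))⁻¹ * deriv (fun t => ∫ y in Ioi t, φ y * (y - t) ^ (-α)) x)

/-- The classical derivative that acts on the test functions: the left weak derivative is tested
with the right classical derivative and vice versa. -/
def dualRLDeriv : Side → ℝ → (ℝ → ℝ) → ℝ → ℝ
  | Side.left => rightRLDeriv
  | Side.right => leftRLDeriv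

/-- `v` is the left (right) weak fractional derivative of order `0 < α < 1` of `u` on the open
set `Ω`. A test function in `C_0^∞(Ω)` is represented by its extension by zero to the line. (The
general sign `(-1)^[α]` is `1` here.) -/
structure IsWeakFracDeriv (s : Side) (α : ℝ) (Ω : Set ℝ) (u v : ℝ → ℝ) : Prop where
  integrableOn : IntegrableOn u Ω
  locallyIntegrableOn : LocallyIntegrableOn v Ω
  integral_eq : ∀ φ : ℝ → ℝ, ContDiff ℝ ∞ φ → HasCompactSupport φ → tsupport φ ⊆ Ω →
    ∫ x in Ω, v x * φ x = ∫ x in Ω, u x * dualRLDeriv s α φ x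

/-- Weak fractional derivatives are unique up to null sets. -/
theorem IsWeakFracDeriv.ae_eq {s : Side} {α : ℝ} {Ω : Set ℝ} {u v w : ℝ → ℝ} (hΩ : IsOpen Ω)
    (hv : IsWeakFracDeriv s α Ω u v) (hw : IsWeakFracDeriv s α Ω u w) :
    v =ᵐ[volume.restrict Ω] w := by
  have key := hΩ.ae_eq_zero_of_integral_contDiff_smul_eq_zero
    (hv.locallyIntegrableOn.sub hw.locallyIntegrableOn) (fun g hg hgc hgs => by
      have hzero : ∀ x, x ∉ Ω → g x = 0 := fun x hx =>
        image_eq_zero_of_notMem_tsupport (fun h => hx (hgs h))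
      have hint : ∀ f : ℝ → ℝ, LocallyIntegrableOn f Ω → Integrable (fun x => f x * g x) := by
        intro f hf
        have h1 : IntegrableOn f (tsupport g) :=
          hf.integrableOn_compact_subset hgs hgc.isCompact
        have h2 : IntegrableOn (fun x => f x * g x) (tsupport g) :=
          h1.mul_continuousOn hg.continuous.continuousOn hgc.isCompact
        refine (integrableOn_iff_integrable_of_support_subset ?_).1 h2
        intro x hx
        exact subset_tsupport g (right_ne_zero_of_mul hx)
      have hset : ∀ f : ℝ → ℝ, ∫ x in Ω, f x * g x = ∫ x, f x * g x := fun f =>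
        setIntegral_eq_integral_of_forall_compl_eq_zero (fun x hx => by simp [hzero x hx])
      have e1 := hv.integral_eq g hg hgc hgs
      have e2 := hw.integral_eq g hg hgc hgs
      rw [hset] at e1 e2
      have e3 : (fun x => g x • (v - w) x) = fun x => v x * g x - w x * g x := by
        funext x
        simp only [Pi.sub_apply, smul_eq_mul]
        ring
      rw [e3, integral_sub (hint v hv.locallyIntegrableOn) (hint w hw.locallyIntegrableOn),
        e1, e2, sub_self])
  rw [Filter.EventuallyEq, ae_restrict_iff' hΩ.measurableSet]
  filter_upwards [key] with x hx hxΩ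
  exact sub_eq_zero.1 (hx hxΩ)

open Classical in
/-- The left (right) weak fractional derivative of `u`, unique up to null sets (and `0` if there
is none). -/
def weakFracDeriv (s : Side) (α : ℝ) (Ω : Set ℝ) (u : ℝ → ℝ) : ℝ → ℝ :=
  if h : ∃ v, IsWeakFracDeriv s α Ω u v then h.choose else 0

/-- `L^p(Ω)`, for a real exponent `p`. -/
abbrev LpOn (p : ℝ) (Ω : Set ℝ) : Type :=
  Lp ℝ (ENNReal.ofReal p) (volume.restrict Ω)

/-- The left (right) fractional Sobolev space of order `0 < α < 1`: the functions in `L^p(Ω)` that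
have a left (right) weak fractional derivative in `L^p(Ω)`. -/
def FracSobolev (s : Side) (α p : ℝ) (Ω : Set ℝ) : Set (LpOn p Ω) :=
  {u | ∃ v, IsWeakFracDeriv s α Ω u v ∧ MemLp v (ENNReal.ofReal p) (volume.restrict Ω)}

/-- The `L^q(Ω)` norm of a function, as a real number. -/
def normLpOn (q : ℝ) (Ω : Set ℝ) (f : ℝ → ℝ) : ℝ :=
  (eLpNorm f (ENNReal.ofReal q) (volume.restrict Ω)).toReal

/-- The norm `(‖u‖_p^p + ‖D^α u‖_p^p)^(1/p)` of the fractional Sobolev space, `1 ≤ p < ∞`. -/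
def fracSobolevNorm (s : Side) (α p : ℝ) (Ω : Set ℝ) (u : ℝ → ℝ) : ℝ :=
  (normLpOn p Ω u ^ p + normLpOn p Ω (weakFracDeriv s α Ω u) ^ p) ^ (1 / p)

/-- The intersection of the left (right) fractional Sobolev space with `L^μ(Ω)`. -/
def FracSobolevInterLp (s : Side) (α p μ : ℝ) (Ω : Set ℝ) : Set (LpOn p Ω) :=
  {u | u ∈ FracSobolev s α p Ω ∧ MemLp u (ENNReal.ofReal μ) (volume.restrict Ω)}

/-- The (essential) support of a measurable function on the line: the complement of the largest
open set on which it vanishes almost everywhere. -/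
def essSupport (f : ℝ → ℝ) : Set ℝ :=
  (⋃₀ {U : Set ℝ | IsOpen U ∧ f =ᵐ[volume.restrict U] 0})ᶜ

end

/-! The extension is by zero; no cut-off function is needed, because the closure [a, b] already lies
in Ω'. The question is only why the extension has a fractional derivative in L^p. The right-sided
case follows from the left-sided one by reflection x ↦ -x.

Write B for `betaConst α`. By Fubini, the weak derivative identity says that the fractional integral
of order 1 - α of u and the primitive of v have the same integrals against every φ'. By du
Bois-Reymond they differ on (a, b) by a constant c. Hölder's inequality for u in L^μ bounds the mean
of the fractional integral over (a, a + ε) by a multiple of ε^(1 - α - 1/μ). Since μ > p/(1 - αp) ≥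
1/(1 - α), this tends to 0 and so c = 0 (`ae_integral_mul_posPow_eq_setIntegral`). A further
fractional integral of order α then gives u as the fractional integral of order α of v on (a, b)
(`ae_eq_indicator_integral_mul_posPow`).

Inserting this representation, cut off at b, into the fractional integral of order 1 - α over the
whole line produces the primitive of v - B⁻¹ T v, where T has the kernel `hardyKernel` and lives on
(b, ∞) (`integral_mul_posPow_eq_setIntegral_extensionDeriv`). This is the derivative of the
extension.

The kernel of T is homogeneous of degree -1 in the distances to b, so T is bounded on L^p with norm
at most ∫_0^∞ t^(α - 1/p)/(1 + t) dt, which is finite exactly because αp < 1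
(`lintegral_rpow_lintegral_mul_hardyKernel_le`). The constant therefore depends on α and p alone;
the L^μ condition serves only to make c vanish. -/

noncomputable section

/-! ### One-sided powers and integration against kernels -/

/-- The one-sided power `t ↦ t_+ ^ e`. -/
def posPow (e t : ℝ) : ℝ := (Ioi (0 : ℝ)).indicator (fun t => t ^ e) t

theorem posPow_of_pos {e t : ℝ} (ht : 0 < t) : posPow e t = t ^ e :=
  indicator_of_mem (s := Ioi (0 : ℝ)) ht _

theorem posPow_of_nonpos {e t : ℝ} (ht : t ≤ 0) : posPow e t = 0 :=
  indicator_of_notMem (s := Ioi (0 : ℝ)) (not_lt.2 ht) _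

theorem posPow_nonneg (e t : ℝ) : 0 ≤ posPow e t :=
  indicator_nonneg (fun _ hx => Real.rpow_nonneg (le_of_lt hx) _) _

theorem measurable_posPow (e : ℝ) : Measurable (posPow e) :=
  (measurable_id.pow_const e).indicator measurableSet_Ioi

theorem integrable_indicator_rpow {e : ℝ} (he : -1 < e) (L : ℝ) :
    Integrable ((Ioo 0 L).indicator (fun t : ℝ => t ^ e)) := by
  rw [integrable_indicator_iff measurableSet_Ioo]
  rcases le_or_gt L 0 with hL | hL
  · rw [Ioo_eq_empty (not_lt.2 hL)]; exact integrableOn_empty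
  · exact (intervalIntegrable_iff_integrableOn_Ioo_of_le hL.le).1
      (intervalIntegral.intervalIntegrable_rpow' he)

/-- Splits the power into an integrable singularity at 0 and a bounded tail, which makes bounds
uniform under translation. -/
theorem posPow_le {e : ℝ} (he : e ≤ 0) (t : ℝ) :
    posPow e t ≤ (Ioo 0 1).indicator (fun t : ℝ => t ^ e) t + 1 := by
  rcases le_or_gt t 0 with h | h
  · rw [posPow_of_nonpos h]
    have : 0 ≤ (Ioo 0 1).indicator (fun t : ℝ => t ^ e) t :=
      indicator_nonneg (fun x hx => Real.rpow_nonneg hx.1.le _) _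
    linarith
  · rw [posPow_of_pos h]
    rcases lt_or_ge t 1 with h1 | h1
    · rw [indicator_of_mem (s := Ioo (0 : ℝ) 1) (mem_Ioo.2 ⟨h, h1⟩)]; linarith
    · rw [indicator_of_notMem (s := Ioo (0 : ℝ) 1) (fun hh => not_lt.2 h1 hh.2)]
      have := Real.rpow_le_one_of_one_le_of_nonpos h1 he
      linarith

theorem locallyIntegrable_posPow {e : ℝ} (he : -1 < e) (he0 : e ≤ 0) :
    LocallyIntegrable (posPow e) := by
  refine ((integrable_indicator_rpow he 1).locallyIntegrable.add
    (locallyIntegrable_const (1 : ℝ))).mono (measurable_posPow e).aestronglyMeasurable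
    (Filter.Eventually.of_forall fun t => ?_)
  rw [Real.norm_of_nonneg (posPow_nonneg e t)]
  exact (posPow_le he0 t).trans (le_abs_self _)

/-- Integrating a bounded integrable function against a translated one-sided power. -/
theorem exists_bound_integral_mul_posPow {e M : ℝ} (he : -1 < e) (he0 : e ≤ 0) {g : ℝ → ℝ}
    (hg : Integrable g) (hM : ∀ z, ‖g z‖ ≤ M) :
    ∃ C : ℝ, ∀ x, Integrable (fun z => g z * posPow e (z - x)) ∧
      ∫ z, ‖g z * posPow e (z - x)‖ ≤ C := by
  set k : ℝ → ℝ := (Ioo 0 1).indicator (fun t : ℝ => t ^ e) with hk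
  have hki : Integrable k := integrable_indicator_rpow he 1
  have hdom : ∀ x, Integrable (fun z => M * k (z - x) + ‖g z‖) := fun x =>
    ((hki.comp_sub_right x).const_mul M).add hg.norm
  have hle : ∀ x z, ‖g z * posPow e (z - x)‖ ≤ M * k (z - x) + ‖g z‖ := by
    intro x z
    have h1 := posPow_le he0 (z - x)
    have hk0 : 0 ≤ k (z - x) := indicator_nonneg (fun x hx => Real.rpow_nonneg hx.1.le _) _
    rw [norm_mul, Real.norm_of_nonneg (posPow_nonneg e _)]
    calc ‖g z‖ * posPow e (z - x) ≤ ‖g z‖ * (k (z - x) + 1) := by gcongr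
      _ = ‖g z‖ * k (z - x) + ‖g z‖ := by ring
      _ ≤ _ := by gcongr; exact hM z
  -- The bound on g controls the singular part of the power and the integral of |g| controls the
  -- tail; neither term depends on x.
  refine ⟨M * (∫ t, k t) + ∫ z, ‖g z‖, fun x => ?_⟩
  have hi : Integrable (fun z => g z * posPow e (z - x)) :=
    (hdom x).mono' (hg.aestronglyMeasurable.mul
      ((measurable_posPow e).comp (measurable_id.sub_const x)).aestronglyMeasurable)
      (Filter.Eventually.of_forall (hle x))
  refine ⟨hi, (integral_mono hi.norm (hdom x) (hle x)).trans (le_of_eq ?_)⟩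
  rw [integral_add ((hki.comp_sub_right x).const_mul M) hg.norm, integral_const_mul,
    integral_sub_right_eq_self k x]

/-- An integrable function times a kernel with uniformly bounded `L^1` sections is integrable on
the product. -/
theorem integrable_mul_kernel {f : ℝ → ℝ} (hf : Integrable f) {κ : ℝ → ℝ → ℝ}
    (hκ : Measurable (Function.uncurry κ)) {C : ℝ}
    (hC : ∀ y, Integrable (κ y) ∧ ∫ x, ‖κ y x‖ ≤ C) :
    Integrable (fun q : ℝ × ℝ => f q.1 * κ q.1 q.2) (volume.prod volume) := by
  have hm : AEStronglyMeasurable (fun q : ℝ × ℝ => f q.1 * κ q.1 q.2) (volume.prod volume) :=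
    hf.aestronglyMeasurable.comp_fst.mul hκ.aestronglyMeasurable
  rw [integrable_prod_iff hm]
  refine ⟨Filter.Eventually.of_forall fun y => (hC y).1.const_mul (f y), ?_⟩
  refine (hf.norm.const_mul C).mono' hm.norm.integral_prod_right'
    (Filter.Eventually.of_forall fun y => ?_)
  have h0 : 0 ≤ ∫ x, ‖f y * κ y x‖ := integral_nonneg fun _ => norm_nonneg _
  rw [Real.norm_of_nonneg h0]
  simp only [norm_mul]
  rw [integral_const_mul, mul_comm]
  exact mul_le_mul_of_nonneg_right (hC y).2 (norm_nonneg _)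

theorem integral_mul_kernel_swap {f : ℝ → ℝ} (hf : Integrable f) {κ : ℝ → ℝ → ℝ}
    (hκ : Measurable (Function.uncurry κ)) {C : ℝ}
    (hC : ∀ y, Integrable (κ y) ∧ ∫ x, ‖κ y x‖ ≤ C) :
    ∫ x, ∫ y, f y * κ y x = ∫ y, f y * ∫ x, κ y x := by
  rw [← integral_integral_swap (f := fun y x => f y * κ y x) (integrable_mul_kernel hf hκ hC)]
  simp only [integral_const_mul]

theorem integrable_integral_mul_kernel {f : ℝ → ℝ} (hf : Integrable f) {κ : ℝ → ℝ → ℝ}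
    (hκ : Measurable (Function.uncurry κ)) {C : ℝ}
    (hC : ∀ y, Integrable (κ y) ∧ ∫ x, ‖κ y x‖ ≤ C) :
    Integrable (fun x => ∫ y, f y * κ y x) :=
  (integrable_mul_kernel hf hκ hC).integral_prod_right

/-! ### The beta integral and the Hardy kernel -/

theorem integrableOn_rpow_div_one_add {c : ℝ} (h0 : -1 < c) (h1 : c < 0) :
    IntegrableOn (fun r : ℝ => r ^ c / (1 + r)) (Ioi 0) := by
  have hm : Measurable (fun r : ℝ => r ^ c / (1 + r)) := by fun_prop
  rw [← Ioc_union_Ioi_eq_Ioi (zero_le_one (α := ℝ))]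
  refine IntegrableOn.union ?_ ?_
  · have h := (intervalIntegrable_iff_integrableOn_Ioc_of_le (zero_le_one (α := ℝ))).1
      (intervalIntegral.intervalIntegrable_rpow' (r := c) h0)
    refine h.mono' hm.aestronglyMeasurable ?_
    filter_upwards [ae_restrict_mem measurableSet_Ioc] with r hr
    have : 0 ≤ r ^ c := Real.rpow_nonneg hr.1.le _
    have h2 : 1 ≤ 1 + r := by linarith [hr.1]
    rw [Real.norm_of_nonneg (by positivity)]
    exact div_le_self this h2
  · have h := integrableOn_Ioi_rpow_of_lt (a := c - 1) (by linarith) (zero_lt_one (α := ℝ))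
    refine h.mono' hm.aestronglyMeasurable ?_
    filter_upwards [ae_restrict_mem measurableSet_Ioi] with r hr
    have hr0 : (0 : ℝ) < r := lt_trans zero_lt_one hr
    have : 0 ≤ r ^ c := Real.rpow_nonneg hr0.le _
    rw [Real.norm_of_nonneg (by positivity), Real.rpow_sub_one hr0.ne']
    gcongr
    linarith

/-- The constant `∫_0^∞ r^(-α) / (1 + r) dr = Γ(α) Γ(1 - α)`. -/
def betaConst (α : ℝ) : ℝ := ∫ r in Ioi (0 : ℝ), r ^ (-α) / (1 + r)

theorem betaConst_pos {α : ℝ} (h0 : 0 < α) (h1 : α < 1) : 0 < betaConst α := by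
  refine (setIntegral_pos_iff_support_of_nonneg_ae ?_
    (integrableOn_rpow_div_one_add (by linarith) (by linarith))).2 ?_
  · filter_upwards [ae_restrict_mem measurableSet_Ioi] with r hr
    have hr : (0 : ℝ) < r := hr
    simp only [Pi.zero_apply]; positivity
  · have : Function.support (fun r : ℝ => r ^ (-α) / (1 + r)) ∩ Ioi 0 = Ioi 0 := by
      refine inter_eq_right.2 fun r hr => ?_
      have hr : (0 : ℝ) < r := hr
      have : 0 < r ^ (-α) / (1 + r) := by positivity
      exact this.ne'
    rw [this, Real.volume_Ioi]
    exact ENNReal.zero_lt_top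

/-- The kernel that carries a left fractional derivative on `(-∞, b)` to that of the extension by
zero on `(b, ∞)`. -/
def hardyKernel (α b y s : ℝ) : ℝ :=
  (Iio b).indicator (fun y => (Ioi b).indicator
    (fun s => (b - y) ^ α * (s - b) ^ (-α) / (s - y)) s) y

theorem hardyKernel_of_lt {α b y s : ℝ} (hy : y < b) (hs : b < s) :
    hardyKernel α b y s = (b - y) ^ α * (s - b) ^ (-α) / (s - y) := by
  rw [hardyKernel, indicator_of_mem (s := Iio b) hy, indicator_of_mem (s := Ioi b) hs]

theorem hardyKernel_of_le_left {α b y s : ℝ} (hy : b ≤ y) : hardyKernel α b y s = 0 :=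
  indicator_of_notMem (s := Iio b) (not_lt.2 hy) _

theorem hardyKernel_of_le_right {α b y s : ℝ} (hs : s ≤ b) : hardyKernel α b y s = 0 := by
  rcases lt_or_ge y b with hy | hy
  · rw [hardyKernel, indicator_of_mem (s := Iio b) hy, indicator_of_notMem (s := Ioi b) (not_lt.2 hs)]
  · exact hardyKernel_of_le_left hy

theorem hardyKernel_nonneg (α b y s : ℝ) : 0 ≤ hardyKernel α b y s := by
  rcases lt_or_ge y b with hy | hy
  · rcases lt_or_ge b s with hs | hs
    · rw [hardyKernel_of_lt hy hs]
      have h1 : 0 < b - y := sub_pos.2 hy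
      have h2 : 0 < s - b := sub_pos.2 hs
      have h3 : 0 < s - y := sub_pos.2 (hy.trans hs)
      positivity
    · rw [hardyKernel_of_le_right hs]
  · rw [hardyKernel_of_le_left hy]

theorem measurable_hardyKernel (α b : ℝ) :
    Measurable (Function.uncurry (hardyKernel α b)) := by
  have : Function.uncurry (hardyKernel α b) = ((fun q : ℝ × ℝ => q.1) ⁻¹' Iio b).indicator
      (((fun q : ℝ × ℝ => q.2) ⁻¹' Ioi b).indicator
        (fun q => (b - q.1) ^ α * (q.2 - b) ^ (-α) / (q.2 - q.1))) := by
    funext q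
    rfl
  rw [this]
  refine Measurable.indicator (Measurable.indicator ?_ (measurable_snd measurableSet_Ioi))
    (measurable_fst measurableSet_Iio)
  fun_prop

theorem hardyKernel_eq_indicator {α b y : ℝ} (hy : y < b) :
    hardyKernel α b y = (Ioi b).indicator
      (fun s => (b - y) ^ α * (s - b) ^ (-α) / (s - y)) := by
  funext s
  rw [hardyKernel, indicator_of_mem (s := Iio b) hy]

/-- The substitution s = b + (b - y) r removes both b and y, so the mass in s is the same for all y
< b. -/
theorem integrable_hardyKernel_and {α : ℝ} (h0 : 0 < α) (h1 : α < 1) {b y : ℝ} (hy : y < b) :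
    Integrable (hardyKernel α b y) ∧ ∫ s, hardyKernel α b y s = betaConst α := by
  have hd : 0 < b - y := sub_pos.2 hy
  set g : ℝ → ℝ := fun s => (b - y) ^ α * (s - b) ^ (-α) / (s - y) with hg
  set f : ℝ → ℝ := fun r => b + (b - y) * r with hf
  have himg : f '' Ioi 0 = Ioi b := by
    ext s
    simp only [hf, mem_image, mem_Ioi]
    constructor
    · rintro ⟨r, hr, rfl⟩
      have := mul_pos hd hr
      linarith
    · intro hs
      refine ⟨(s - b) / (b - y), div_pos (sub_pos.2 hs) hd, ?_⟩
      field_simp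
      ring
  have hder : ∀ x ∈ Ioi (0 : ℝ), HasDerivWithinAt f ((fun _ => b - y) x) (Ioi 0) x := by
    intro x _
    have := ((hasDerivAt_id x).const_mul (b - y)).const_add b
    simpa [hf] using this.hasDerivWithinAt
  have hinj : InjOn f (Ioi 0) := by
    intro r _ r' _ h
    simp only [hf] at h
    have : (b - y) * r = (b - y) * r' := by linarith
    exact mul_left_cancel₀ hd.ne' this
  have hpt : ∀ r ∈ Ioi (0 : ℝ), |b - y| • g (f r) = r ^ (-α) / (1 + r) := by
    intro r hr
    have hr : (0 : ℝ) < r := hr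
    simp only [hg, hf, smul_eq_mul]
    rw [abs_of_pos hd, show b + (b - y) * r - b = (b - y) * r by ring,
      show b + (b - y) * r - y = (b - y) * (1 + r) by ring,
      Real.mul_rpow hd.le hr.le, Real.rpow_neg hd.le]
    have : (b - y) ^ α ≠ 0 := (Real.rpow_pos_of_pos hd _).ne'
    field_simp
  rw [hardyKernel_eq_indicator hy, integrable_indicator_iff measurableSet_Ioi,
    integral_indicator measurableSet_Ioi, ← himg]
  constructor
  · rw [integrableOn_image_iff_integrableOn_abs_deriv_smul measurableSet_Ioi hder hinj]
    exact (integrableOn_congr_fun hpt measurableSet_Ioi).2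
      (integrableOn_rpow_div_one_add (by linarith) (by linarith))
  · rw [integral_image_eq_integral_abs_deriv_smul measurableSet_Ioi hder hinj]
    exact setIntegral_congr_fun measurableSet_Ioi hpt

/-- The substitution x = y + (z - y)(b - y)/(s - y) maps (z, ∞) onto (y, b), reversing the order,
and turns the product of the two powers into the Hardy kernel. A truncated beta integral is thus a
tail of the kernel, and the full beta integral when z = b. -/
theorem integrableOn_mul_rpow_and {α : ℝ} (h0 : 0 < α) (h1 : α < 1) {b y z : ℝ} (hy : y < b)
    (hz : b ≤ z) :
    IntegrableOn (fun x => (x - y) ^ (α - 1) * (z - x) ^ (-α)) (Ioo y b) ∧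
      ∫ x in Ioo y b, (x - y) ^ (α - 1) * (z - x) ^ (-α) = ∫ s in Ioi z, hardyKernel α b y s := by
  have hd : 0 < b - y := sub_pos.2 hy
  have hzy : 0 < z - y := by linarith
  set g : ℝ → ℝ := fun x => (x - y) ^ (α - 1) * (z - x) ^ (-α) with hg
  set f : ℝ → ℝ := fun s => y + (z - y) * (b - y) / (s - y) with hf
  have himg : f '' Ioi z = Ioo y b := by
    ext x
    simp only [hf, mem_image, mem_Ioi, mem_Ioo]
    constructor
    · rintro ⟨s, hs, rfl⟩
      have hsy : 0 < s - y := by linarith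
      constructor
      · have : 0 < (z - y) * (b - y) / (s - y) := by positivity
        linarith
      · have : (z - y) * (b - y) / (s - y) < b - y := by
          rw [div_lt_iff₀ hsy, mul_comm]
          gcongr
        linarith
    · rintro ⟨hx, hxb⟩
      have hxy : 0 < x - y := sub_pos.2 hx
      refine ⟨y + (z - y) * (b - y) / (x - y), ?_, ?_⟩
      · have : z - y < (z - y) * (b - y) / (x - y) := by
          rw [lt_div_iff₀ hxy]
          gcongr
        linarith
      · have h3 : (z - y) * (b - y) ≠ 0 := by positivity
        rw [add_sub_cancel_left, div_div_cancel₀ h3]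
        ring
  have hder : ∀ s ∈ Ioi z, HasDerivWithinAt f ((fun s => -((z - y) * (b - y) / (s - y) ^ 2)) s)
      (Ioi z) s := by
    intro s hs
    have hs : z < s := hs
    have hsy : s - y ≠ 0 := by linarith
    have := (((hasDerivAt_id s).sub_const y).inv hsy).const_mul ((z - y) * (b - y)) |>.const_add y
    refine HasDerivAt.hasDerivWithinAt ?_
    convert! this using 1
    simp only [id]
    ring
  have hinj : InjOn f (Ioi z) := by
    intro s hs s' hs' h
    have hs : z < s := hs
    have hs' : z < s' := hs'
    simp only [hf] at h
    have h3 : (z - y) * (b - y) ≠ 0 := by positivity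
    have h4 : s - y ≠ 0 := by linarith
    have h5 : s' - y ≠ 0 := by linarith
    have h6 : (z - y) * (b - y) / (s - y) = (z - y) * (b - y) / (s' - y) := by linarith
    rw [div_eq_div_iff h4 h5] at h6
    have := mul_left_cancel₀ h3 h6
    linarith
  have hpt : ∀ s ∈ Ioi z, |-((z - y) * (b - y) / (s - y) ^ 2)| • g (f s) = hardyKernel α b y s := by
    intro s hs
    have hs : z < s := hs
    have hsy : 0 < s - y := by linarith
    have hsb : 0 < s - b := by linarith
    rw [hardyKernel_of_lt hy (by linarith)]
    simp only [hg, hf, smul_eq_mul]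
    rw [abs_neg, abs_of_pos (by positivity),
      show y + (z - y) * (b - y) / (s - y) - y = (z - y) * ((b - y) / (s - y)) by ring,
      show z - (y + (z - y) * (b - y) / (s - y)) = (z - y) * ((s - b) / (s - y)) by
        field_simp; ring,
      Real.mul_rpow hzy.le (by positivity), Real.mul_rpow hzy.le (by positivity),
      Real.div_rpow hd.le hsy.le, Real.div_rpow hsb.le hsy.le, Real.rpow_sub_one hzy.ne',
      Real.rpow_sub_one hd.ne', Real.rpow_sub_one hsy.ne', Real.rpow_neg hzy.le,
      Real.rpow_neg hsy.le]
    have e1 : (z - y) ^ α ≠ 0 := (Real.rpow_pos_of_pos hzy _).ne'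
    have e2 : (s - y) ^ α ≠ 0 := (Real.rpow_pos_of_pos hsy _).ne'
    field_simp
  rw [← himg]
  constructor
  · rw [integrableOn_image_iff_integrableOn_abs_deriv_smul measurableSet_Ioi hder hinj]
    exact (integrableOn_congr_fun hpt measurableSet_Ioi).2
      (integrable_hardyKernel_and h0 h1 hy).1.integrableOn
  · rw [integral_image_eq_integral_abs_deriv_smul measurableSet_Ioi hder hinj]
    exact setIntegral_congr_fun measurableSet_Ioi hpt

theorem integrable_posPow_mul_posPow_and {α : ℝ} (h0 : 0 < α) (h1 : α < 1) {b z : ℝ}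
    (hz : b ≤ z) (y : ℝ) :
    Integrable ((Iio b).indicator fun x => posPow (α - 1) (x - y) * posPow (-α) (z - x)) ∧
      ∫ x, (Iio b).indicator (fun x => posPow (α - 1) (x - y) * posPow (-α) (z - x)) x =
        ∫ s in Ioi z, hardyKernel α b y s := by
  rcases lt_or_ge y b with hy | hy
  · have : (Iio b).indicator (fun x => posPow (α - 1) (x - y) * posPow (-α) (z - x)) =
        (Ioo y b).indicator fun x => (x - y) ^ (α - 1) * (z - x) ^ (-α) := by
      funext x
      by_cases hxb : x < b
      · rw [indicator_of_mem (s := Iio b) hxb]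
        rcases lt_or_ge y x with hx | hx
        · rw [indicator_of_mem (s := Ioo y b) (mem_Ioo.2 ⟨hx, hxb⟩), posPow_of_pos (sub_pos.2 hx),
            posPow_of_pos (by linarith)]
        · rw [indicator_of_notMem (s := Ioo y b) (fun h => not_lt.2 hx h.1),
            posPow_of_nonpos (by linarith), zero_mul]
      · rw [indicator_of_notMem (s := Iio b) hxb,
          indicator_of_notMem (s := Ioo y b) (fun h => hxb h.2)]
    rw [this, integrable_indicator_iff measurableSet_Ioo, integral_indicator measurableSet_Ioo]
    exact integrableOn_mul_rpow_and h0 h1 hy hz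
  · have : (Iio b).indicator (fun x => posPow (α - 1) (x - y) * posPow (-α) (z - x)) =
        fun _ => 0 := by
      funext x
      refine indicator_apply_eq_zero.2 fun hx => ?_
      have hx : x < b := hx
      rw [posPow_of_nonpos (by linarith), zero_mul]
    simp only [this, hardyKernel_of_le_left hy]
    simp

theorem measurable_indicator_posPow_mul_posPow (α b z : ℝ) :
    Measurable (Function.uncurry fun y x : ℝ =>
      (Iio b).indicator (fun x => posPow (α - 1) (x - y) * posPow (-α) (z - x)) x) := by
  have : (Function.uncurry fun y x : ℝ =>
      (Iio b).indicator (fun x => posPow (α - 1) (x - y) * posPow (-α) (z - x)) x) =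
      ((fun q : ℝ × ℝ => q.2) ⁻¹' Iio b).indicator
        (fun q => posPow (α - 1) (q.2 - q.1) * posPow (-α) (z - q.2)) := rfl
  rw [this]
  exact (((measurable_posPow _).comp (measurable_snd.sub measurable_fst)).mul
    ((measurable_posPow _).comp (measurable_const.sub measurable_snd))).indicator
    (measurable_snd measurableSet_Iio)

theorem integral_norm_hardyKernel_le {α : ℝ} (h0 : 0 < α) (h1 : α < 1) (b y : ℝ) :
    Integrable (hardyKernel α b y) ∧ ∫ s, ‖hardyKernel α b y s‖ ≤ betaConst α := by
  simp only [Real.norm_of_nonneg (hardyKernel_nonneg α b _ _)]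
  rcases lt_or_ge y b with hy | hy
  · exact ⟨(integrable_hardyKernel_and h0 h1 hy).1, (integrable_hardyKernel_and h0 h1 hy).2.le⟩
  · have : hardyKernel α b y = fun _ => 0 := funext fun s => hardyKernel_of_le_left hy
    simp only [this, integral_zero]
    exact ⟨integrable_zero _ _ _, (betaConst_pos h0 h1).le⟩

/-! ### Composition of fractional integrals -/

/-- Fractional integrals of orders `1 - α` and `α` composed, with a cut-off at `b` between them. -/
theorem integral_Iio_posPow_mul_integral {α : ℝ} (h0 : 0 < α) (h1 : α < 1) {f : ℝ → ℝ}
    (hf : Integrable f) {b z : ℝ} (hz : b ≤ z) :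
    ∫ x in Iio b, posPow (-α) (z - x) * ∫ y, f y * posPow (α - 1) (x - y) =
      ∫ y, f y * ∫ s in Ioi z, hardyKernel α b y s := by
  have key := integral_mul_kernel_swap hf (measurable_indicator_posPow_mul_posPow α b z)
    (C := betaConst α) (fun y => by
      obtain ⟨hi, he⟩ := integrable_posPow_mul_posPow_and h0 h1 hz y
      refine ⟨hi, ?_⟩
      have hn : ∀ x, 0 ≤ (Iio b).indicator
          (fun x => posPow (α - 1) (x - y) * posPow (-α) (z - x)) x := fun x =>
        indicator_nonneg (fun x _ => mul_nonneg (posPow_nonneg _ _) (posPow_nonneg _ _)) x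
      simp only [Real.norm_of_nonneg (hn _)]
      rw [he]
      obtain ⟨hK, hB⟩ := integral_norm_hardyKernel_le h0 h1 b y
      simp only [Real.norm_of_nonneg (hardyKernel_nonneg α b _ _)] at hB
      exact (setIntegral_le_integral hK (Filter.Eventually.of_forall
        fun s => hardyKernel_nonneg α b y s)).trans hB)
  simp only [(integrable_posPow_mul_posPow_and h0 h1 hz _).2] at key
  rw [← key, ← integral_indicator measurableSet_Iio]
  refine integral_congr_ae (Filter.Eventually.of_forall fun x => ?_)
  by_cases hx : x ∈ Iio b
  · simp only [indicator_of_mem hx]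
    rw [← integral_const_mul]
    refine integral_congr_ae (Filter.Eventually.of_forall fun y => ?_)
    simp only
    ring
  · simp only [indicator_of_notMem hx, mul_zero, integral_zero]

theorem setIntegral_Ioi_hardyKernel_self {α : ℝ} (h0 : 0 < α) (h1 : α < 1) (b y : ℝ) :
    ∫ s in Ioi b, hardyKernel α b y s = (Iio b).indicator (fun _ => betaConst α) y := by
  rw [setIntegral_eq_integral_of_forall_compl_eq_zero (s := Ioi b)
    (fun s hs => hardyKernel_of_le_right (not_lt.1 hs))]
  by_cases hy : y ∈ Iio b
  · rw [indicator_of_mem hy, (integrable_hardyKernel_and h0 h1 hy).2]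
  · rw [indicator_of_notMem hy]
    simp only [hardyKernel_of_le_left (not_lt.1 hy), integral_zero]

/-- The fractional integrals of orders `1 - α` and `α` compose to the primitive. -/
theorem integral_posPow_mul_integral {α : ℝ} (h0 : 0 < α) (h1 : α < 1) {f : ℝ → ℝ}
    (hf : Integrable f) (z : ℝ) :
    ∫ x, posPow (-α) (z - x) * ∫ y, f y * posPow (α - 1) (x - y) =
      betaConst α * ∫ y in Iio z, f y := by
  have h := integral_Iio_posPow_mul_integral h0 h1 hf (le_refl z)
  rw [setIntegral_eq_integral_of_forall_compl_eq_zero (fun x hx => by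
    rw [posPow_of_nonpos (sub_nonpos.2 (not_lt.1 hx)), zero_mul])] at h
  rw [h, ← integral_const_mul, ← integral_indicator measurableSet_Iio]
  refine integral_congr_ae (Filter.Eventually.of_forall fun y => ?_)
  simp only
  rw [setIntegral_Ioi_hardyKernel_self h0 h1]
  by_cases hy : y ∈ Iio z
  · rw [indicator_of_mem hy, indicator_of_mem hy, mul_comm]
  · rw [indicator_of_notMem hy, indicator_of_notMem hy, mul_zero]

/-! ### Testing against Riemann-Liouville derivatives -/

/-- The integral is the convolution of φ with the reflected, locally integrable power, so the
derivative can be moved onto φ. -/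
theorem rightRLDeriv_eq {α : ℝ} (h0 : 0 < α) (h1 : α < 1) {φ : ℝ → ℝ} (hφ : ContDiff ℝ ∞ φ)
    (hc : HasCompactSupport φ) (x : ℝ) :
    rightRLDeriv α φ x =
      -((Real.Gamma (1 - α))⁻¹ * ∫ z, deriv φ z * posPow (-α) (z - x)) := by
  have hk : LocallyIntegrable (fun t => posPow (-α) (-t)) := by
    have h := locallyIntegrable_posPow (e := -α) (by linarith) (by linarith)
    intro t
    obtain ⟨U, hU, hi⟩ := h (-t)
    refine ⟨Neg.neg ⁻¹' U, continuous_neg.continuousAt.preimage_mem_nhds hU, ?_⟩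
    have hmp : MeasurePreserving (Neg.neg : ℝ → ℝ) volume volume :=
      Measure.measurePreserving_neg volume
    exact (hmp.integrableOn_comp_preimage (MeasurableEquiv.neg ℝ).measurableEmbedding).2 hi
  have hd := hc.hasDerivAt_convolution_right (ContinuousLinearMap.lsmul ℝ ℝ) (μ := volume) hk
    (hφ.of_le (by simp)) x
  have e1 : (fun t => ∫ y in Ioi t, φ y * (y - t) ^ (-α)) =
      convolution (fun t => posPow (-α) (-t)) φ (ContinuousLinearMap.lsmul ℝ ℝ) volume := by
    funext t
    rw [convolution_lsmul_swap, ← integral_indicator measurableSet_Ioi]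
    refine integral_congr_ae (Filter.Eventually.of_forall fun y => ?_)
    simp only [neg_sub, smul_eq_mul]
    by_cases hy : y ∈ Ioi t
    · rw [indicator_of_mem hy, posPow_of_pos (sub_pos.2 hy), mul_comm]
    · rw [indicator_of_notMem hy, posPow_of_nonpos (sub_nonpos.2 (not_lt.1 hy)), zero_mul]
  rw [rightRLDeriv, e1, hd.deriv, convolution_lsmul_swap]
  simp only [neg_sub, smul_eq_mul]
  simp only [mul_comm]

theorem exists_norm_deriv_le {φ : ℝ → ℝ} (hφ : ContDiff ℝ ∞ φ) (hc : HasCompactSupport φ) :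
    Integrable (deriv φ) ∧ Measurable (deriv φ) ∧ ∃ M, ∀ z, ‖deriv φ z‖ ≤ M := by
  have hcont : Continuous (deriv φ) := hφ.continuous_deriv (by simp)
  exact ⟨hcont.integrable_of_hasCompactSupport hc.deriv, hcont.measurable,
    hcont.bounded_above_of_compact_support hc.deriv⟩

/-- Fubini moves the kernel from φ' to f. Together with `integral_mul_eq_neg_integral_deriv_mul`,
this reduces the weak derivative identity to a comparison of two functions tested against φ'. -/
theorem integral_mul_rightRLDeriv {α : ℝ} (h0 : 0 < α) (h1 : α < 1) {f : ℝ → ℝ}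
    (hf : Integrable f) {φ : ℝ → ℝ} (hφ : ContDiff ℝ ∞ φ) (hc : HasCompactSupport φ) :
    ∫ x, f x * rightRLDeriv α φ x =
      -∫ z, deriv φ z * ((Real.Gamma (1 - α))⁻¹ * ∫ x, f x * posPow (-α) (z - x)) := by
  obtain ⟨hi, hm, M, hM⟩ := exists_norm_deriv_le hφ hc
  obtain ⟨C, hC⟩ := exists_bound_integral_mul_posPow (e := -α) (by linarith) (by linarith) hi hM
  have key := integral_mul_kernel_swap hf (κ := fun x z => deriv φ z * posPow (-α) (z - x))
    ((hm.comp measurable_snd).mul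
      ((measurable_posPow _).comp (measurable_snd.sub measurable_fst))) hC
  have e1 : ∀ x, f x * rightRLDeriv α φ x =
      -(Real.Gamma (1 - α))⁻¹ * (f x * ∫ z, deriv φ z * posPow (-α) (z - x)) := fun x => by
    rw [rightRLDeriv_eq h0 h1 hφ hc]; ring
  simp only [e1]
  rw [integral_const_mul, ← key, neg_mul, ← integral_const_mul]
  congr 1
  refine integral_congr_ae (Filter.Eventually.of_forall fun z => ?_)
  simp only
  rw [← integral_const_mul, ← integral_const_mul, ← integral_const_mul]
  refine integral_congr_ae (Filter.Eventually.of_forall fun x => ?_)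
  simp only
  ring

theorem integral_mul_eq_neg_integral_deriv_mul {f : ℝ → ℝ} (hf : Integrable f) {φ : ℝ → ℝ}
    (hφ : ContDiff ℝ ∞ φ) (hc : HasCompactSupport φ) :
    ∫ x, f x * φ x = -∫ z, deriv φ z * ∫ x in Iio z, f x := by
  obtain ⟨hi, hm, -⟩ := exists_norm_deriv_le hφ hc
  have key := integral_mul_kernel_swap hf (κ := fun x z => (Ioi x).indicator (deriv φ) z)
    (C := ∫ z, ‖deriv φ z‖) (by
      have : (Function.uncurry fun x z : ℝ => (Ioi x).indicator (deriv φ) z) =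
          {q : ℝ × ℝ | q.1 < q.2}.indicator (fun q => deriv φ q.2) := rfl
      rw [this]
      exact (hm.comp measurable_snd).indicator (measurableSet_lt measurable_fst measurable_snd))
    (fun x => ⟨hi.indicator measurableSet_Ioi, integral_mono
      (hi.indicator measurableSet_Ioi).norm hi.norm fun z => norm_indicator_le_norm_self _ _⟩)
  simp only [integral_indicator measurableSet_Ioi,
    hc.integral_Ioi_deriv_eq (hφ.of_le (by simp))] at key
  have e2 : ∫ x, f x * φ x = -∫ x, f x * -φ x := by
    rw [← integral_neg]; simp only [mul_neg, neg_neg]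
  rw [e2, ← key]
  congr 1
  refine integral_congr_ae (Filter.Eventually.of_forall fun z => ?_)
  simp only
  rw [← integral_const_mul, ← integral_indicator measurableSet_Iio]
  refine integral_congr_ae (Filter.Eventually.of_forall fun x => ?_)
  simp only
  by_cases h : x < z
  · rw [indicator_of_mem (s := Ioi x) h, indicator_of_mem (s := Iio z) h, mul_comm]
  · rw [indicator_of_notMem (s := Ioi x) h, indicator_of_notMem (s := Iio z) h, mul_zero]

/-! ### The constant of integration -/

/-- The lemma of du Bois-Reymond on an interval. -/
theorem exists_ae_eq_const_of_integral_mul_deriv_eq_zero {a b : ℝ} (hab : a < b) {D : ℝ → ℝ}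
    (hD : Integrable D) (h : ∀ φ : ℝ → ℝ, ContDiff ℝ ∞ φ → HasCompactSupport φ →
      tsupport φ ⊆ Ioo a b → ∫ x, D x * deriv φ x = 0) :
    ∃ c : ℝ, ∀ᵐ x, x ∈ Ioo a b → D x = c := by
  have hmid : (a + b) / 2 ∈ Ioo a b := ⟨by linarith, by linarith⟩
  obtain ⟨η, hηs, hηc, hη, hηr, hη1⟩ := exists_contDiff_tsupport_subset (n := ⊤)
    (isOpen_Ioo.mem_nhds hmid)
  have hη0 : ∀ x, 0 ≤ η x := fun x => (hηr (mem_range_self x)).1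
  have hηi : Integrable η := hη.continuous.integrable_of_hasCompactSupport hηc
  have hm : 0 < ∫ x, η x := hη.continuous.integral_pos_of_hasCompactSupport_nonneg_nonzero
    hηc hη0 (x := (a + b) / 2) (by rw [hη1]; exact one_ne_zero)
  refine ⟨(∫ x, D x * η x) / ∫ x, η x, ?_⟩
  set c := (∫ x, D x * η x) / ∫ x, η x with hc
  have hbd : ∀ g : ℝ → ℝ, Continuous g → HasCompactSupport g →
      Integrable (fun x => D x * g x) := fun g hg hgc => by
    obtain ⟨M, hM⟩ := hg.bounded_above_of_compact_support hgc
    exact hD.mul_bdd (c := M) hg.aestronglyMeasurable (Filter.Eventually.of_forall hM)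
  have key := isOpen_Ioo.ae_eq_zero_of_integral_contDiff_smul_eq_zero (U := Ioo a b)
    (f := fun x => D x - c) (μ := volume)
    ((hD.locallyIntegrable.sub (locallyIntegrable_const c)).locallyIntegrableOn _)
    (fun ψ hψ hψc hψs => by
      have hψi : Integrable ψ := hψ.continuous.integrable_of_hasCompactSupport hψc
      -- Subtracting the multiple m of the bump η gives θ mean zero, so that its primitive is again
      -- a test function on (a, b). The constant c is the η-weighted mean of D.
      set m := (∫ x, ψ x) / ∫ x, η x with hmdef
      set θ : ℝ → ℝ := fun x => ψ x - m * η x with hθ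
      have hθs : ContDiff ℝ ∞ θ := hψ.sub (contDiff_const.mul hη)
      have hθ0 : ∫ x, θ x = 0 := by
        rw [integral_sub hψi (hηi.const_mul m), integral_const_mul, hmdef,
          div_mul_cancel₀ _ hm.ne', sub_self]
      have hKc : IsCompact (tsupport ψ ∪ tsupport η) := hψc.isCompact.union hηc.isCompact
      have hKne : (tsupport ψ ∪ tsupport η).Nonempty :=
        ⟨(a + b) / 2, Or.inr (subset_tsupport η (by simp [hη1]))⟩
      obtain ⟨a', ha'K, ha'⟩ := hKc.exists_isLeast hKne
      obtain ⟨b', hb'K, hb'⟩ := hKc.exists_isGreatest hKne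
      have hKab : tsupport ψ ∪ tsupport η ⊆ Ioo a b := union_subset hψs hηs
      have hθz : ∀ x, x ∉ Icc a' b' → θ x = 0 := by
        intro x hx
        have hxK : x ∉ tsupport ψ ∪ tsupport η := fun hxK => hx ⟨ha' hxK, hb' hxK⟩
        simp only [hθ]
        rw [image_eq_zero_of_notMem_tsupport (fun h => hxK (Or.inl h)),
          image_eq_zero_of_notMem_tsupport (fun h => hxK (Or.inr h))]
        ring
      set φ : ℝ → ℝ := fun x => ∫ t in a..x, θ t with hφ
      have hder : ∀ x, HasDerivAt φ (θ x) x := fun x =>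
        (hθs.continuous.integral_hasStrictDerivAt a x).hasDerivAt
      have hdφ : deriv φ = θ := funext fun x => (hder x).deriv
      have hφs : ContDiff ℝ ∞ φ :=
        contDiff_infty_iff_deriv.2 ⟨fun x => (hder x).differentiableAt, hdφ ▸ hθs⟩
      -- Left of a' nothing has been integrated yet; right of b' the primitive equals the whole
      -- integral of θ, which is zero.
      have hφz : ∀ x, x ∉ Icc a' b' → φ x = 0 := by
        intro x hx
        rcases lt_or_ge x a' with h1 | h1
        · simp only [hφ]
          rw [intervalIntegral.integral_congr (g := fun _ => (0 : ℝ)) (fun t ht => ?_)]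
          · simp
          · refine hθz t fun h2 => ?_
            have := (hKab ha'K).1
            have h3 := ht.2
            rcases max_cases a x with h4 | h4 <;> linarith [h2.1]
        · have h2 : b' < x := lt_of_not_ge fun h2 => hx ⟨h1, h2⟩
          simp only [hφ]
          rw [intervalIntegral.integral_eq_integral_of_support_subset, hθ0]
          intro t ht
          have h3 : t ∈ Icc a' b' := by
            by_contra h3
            exact ht (hθz t h3)
          exact ⟨(hKab ha'K).1.trans_le h3.1, h3.2.trans h2.le⟩
      have hsub : tsupport φ ⊆ Icc a' b' :=
        closure_minimal (fun x hx => by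
          by_contra h3
          exact hx (hφz x h3)) isClosed_Icc
      have h0 := h φ hφs (HasCompactSupport.of_support_subset_isCompact isCompact_Icc
        ((subset_tsupport φ).trans hsub))
        (hsub.trans (Icc_subset_Ioo (hKab ha'K).1 (hKab hb'K).2))
      rw [hdφ] at h0
      have e1 : ∫ x, D x * θ x = (∫ x, D x * ψ x) - m * ∫ x, D x * η x := by
        rw [← integral_const_mul, ← integral_sub (hbd ψ hψ.continuous hψc)
          ((hbd η hη.continuous hηc).const_mul m)]
        refine integral_congr_ae (Filter.Eventually.of_forall fun x => ?_)
        simp only [hθ]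
        ring
      have e2 : ∫ x, ψ x • (D x - c) = (∫ x, D x * ψ x) - c * ∫ x, ψ x := by
        rw [← integral_const_mul, ← integral_sub (hbd ψ hψ.continuous hψc)
          (hψi.const_mul c)]
        refine integral_congr_ae (Filter.Eventually.of_forall fun x => ?_)
        simp only [smul_eq_mul]
        ring
      rw [e2, hc]
      rw [e1, hmdef] at h0
      rw [← h0]
      ring)
  filter_upwards [key] with x hx hxI
  exact sub_eq_zero.1 (hx hxI)

theorem ae_eq_zero_of_setIntegral_Iio_eq_zero {f : ℝ → ℝ} (hf : Integrable f)
    (h : ∀ z, ∫ x in Iio z, f x = 0) : f =ᵐ[volume] 0 := by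
  refine ae_eq_zero_of_integral_contDiff_smul_eq_zero hf.locallyIntegrable fun ψ hψ hψc => ?_
  have := integral_mul_eq_neg_integral_deriv_mul hf hψ hψc
  simp only [h, mul_zero, integral_zero, neg_zero] at this
  simpa only [smul_eq_mul, mul_comm] using this

/-- Hölder's inequality against the constant 1, with the L^q norm on (a, b) as Λ. -/
theorem exists_setIntegral_norm_le_rpow {q a b : ℝ} (hq : 1 ≤ q) {u : ℝ → ℝ}
    (hu : MemLp u (ENNReal.ofReal q) (volume.restrict (Ioo a b))) :
    ∃ Λ : ℝ, ∀ ε, 0 < ε → ε < b - a → ∫ x in Ioo a (a + ε), ‖u x‖ ≤ Λ * ε ^ (1 - 1 / q) := by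
  refine ⟨(eLpNorm u (ENNReal.ofReal q) (volume.restrict (Ioo a b))).toReal, fun ε h0 h1 => ?_⟩
  have hsub : Ioo a (a + ε) ⊆ Ioo a b := Ioo_subset_Ioo_right (by linarith)
  have hm : AEStronglyMeasurable u (volume.restrict (Ioo a (a + ε))) :=
    hu.aestronglyMeasurable.mono_set hsub
  have h := eLpNorm_le_eLpNorm_mul_rpow_measure_univ (p := 1) (q := ENNReal.ofReal q)
    (by simpa using ENNReal.ofReal_le_ofReal hq) hm
  have h2 := h.trans (mul_le_mul_left (eLpNorm_mono_measure u
    (Measure.restrict_mono hsub le_rfl)) _)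
  rw [Measure.restrict_apply_univ, Real.volume_Ioo, add_sub_cancel_left, ENNReal.toReal_one,
    ENNReal.toReal_ofReal (by linarith), div_one,
    ENNReal.ofReal_rpow_of_pos h0] at h2
  rw [integral_norm_eq_lintegral_enorm hm, ← eLpNorm_one_eq_lintegral_enorm]
  have h3 := ENNReal.toReal_mono (ENNReal.mul_ne_top hu.eLpNorm_ne_top ENNReal.ofReal_ne_top) h2
  rwa [ENNReal.toReal_mul, ENNReal.toReal_ofReal (by positivity)] at h3

/-- The fractional integral of a function supported to the right of `a`, averaged over
`(a, a + ε)`. -/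
theorem setIntegral_norm_integral_mul_posPow_le {α : ℝ} (h1 : α < 1) {f : ℝ → ℝ}
    (hf : Integrable f) {a ε : ℝ} (hε : 0 < ε) (hfa : ∀ x ≤ a, f x = 0) :
    ∫ z in Ioo a (a + ε), ‖∫ x, f x * posPow (-α) (z - x)‖ ≤
      ε ^ (1 - α) / (1 - α) * ∫ x in Ioo a (a + ε), ‖f x‖ := by
  -- For z in (a, a + ε) and f supported to the right of a, only lags z - x in (0, ε) occur. The
  -- truncated kernel k is integrable with mass ε^(1 - α)/(1 - α), and Young's inequality for L^1
  -- applies.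
  set k : ℝ → ℝ := (Ioo 0 ε).indicator (fun t : ℝ => t ^ (-α)) with hk
  have hki : Integrable k := integrable_indicator_rpow (by linarith) ε
  have hk0 : ∀ t, 0 ≤ k t := indicator_nonneg (fun x hx => Real.rpow_nonneg hx.1.le _)
  have hkint : ∫ t, k t = ε ^ (1 - α) / (1 - α) := by
    rw [hk, integral_indicator measurableSet_Ioo, ← integral_Ioc_eq_integral_Ioo,
      ← intervalIntegral.integral_of_le hε.le, integral_rpow (Or.inl (by linarith)),
      show -α + 1 = 1 - α by ring, Real.zero_rpow (by linarith), sub_zero]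
  set f1 : ℝ → ℝ := (Ioo a (a + ε)).indicator (fun x => ‖f x‖) with hf1
  have hf1i : Integrable f1 := hf.norm.indicator measurableSet_Ioo
  have hkm : Measurable k :=
    (measurable_id.pow_const (-α)).indicator measurableSet_Ioo
  have hκ : Measurable (Function.uncurry fun x z : ℝ => k (z - x)) :=
    hkm.comp (measurable_snd.sub measurable_fst)
  have hC : ∀ x, Integrable (fun z => k (z - x)) ∧ ∫ z, ‖k (z - x)‖ ≤ ε ^ (1 - α) / (1 - α) := by
    intro x
    refine ⟨hki.comp_sub_right x, le_of_eq ?_⟩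
    simp only [Real.norm_of_nonneg (hk0 _)]
    rw [integral_sub_right_eq_self k x, hkint]
  have hpt : ∀ z ∈ Ioo a (a + ε), ‖∫ x, f x * posPow (-α) (z - x)‖ ≤ ∫ x, f1 x * k (z - x) := by
    intro z hz
    refine (norm_integral_le_integral_norm _).trans (le_of_eq ?_)
    refine integral_congr_ae (Filter.Eventually.of_forall fun x => ?_)
    simp only
    rw [norm_mul, Real.norm_of_nonneg (posPow_nonneg _ _)]
    rcases le_or_gt x a with hx | hx
    · rw [hfa x hx, hf1, indicator_of_notMem (s := Ioo a (a + ε)) (fun h => not_lt.2 hx h.1)]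
      simp
    rcases lt_or_ge x z with hxz | hxz
    · rw [hf1, indicator_of_mem (s := Ioo a (a + ε)) (mem_Ioo.2 ⟨hx, hxz.trans hz.2⟩), hk,
        indicator_of_mem (s := Ioo 0 ε) (mem_Ioo.2 ⟨sub_pos.2 hxz, by linarith [hz.2]⟩),
        posPow_of_pos (sub_pos.2 hxz)]
    · rw [posPow_of_nonpos (sub_nonpos.2 hxz), hk,
        indicator_of_notMem (s := Ioo 0 ε) (fun h => not_lt.2 hxz (sub_pos.1 h.1))]
      simp
  have hI := integrable_integral_mul_kernel hf1i hκ hC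
  have hpos : ∀ z, 0 ≤ ∫ x, f1 x * k (z - x) := fun z => integral_nonneg fun x =>
    mul_nonneg (indicator_nonneg (fun _ _ => norm_nonneg _) x) (hk0 _)
  have hswap := integral_mul_kernel_swap hf1i hκ hC
  have e3 : ∀ x, ∫ z, k (z - x) = ε ^ (1 - α) / (1 - α) := fun x => by
    rw [integral_sub_right_eq_self k x, hkint]
  simp only [e3] at hswap
  rw [integral_mul_const, hf1, integral_indicator measurableSet_Ioo, mul_comm] at hswap
  rw [← hswap]
  calc ∫ z in Ioo a (a + ε), ‖∫ x, f x * posPow (-α) (z - x)‖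
      ≤ ∫ z in Ioo a (a + ε), ∫ x, f1 x * k (z - x) := by
        refine integral_mono_of_nonneg (Filter.Eventually.of_forall fun z => norm_nonneg _)
          hI.integrableOn ?_
        filter_upwards [ae_restrict_mem measurableSet_Ioo] with z hz
        exact hpt z hz
    _ ≤ ∫ z, ∫ x, f1 x * k (z - x) :=
        setIntegral_le_integral hI (Filter.Eventually.of_forall hpos)

/-- The primitive need not be integrable on the line, hence the restriction to a bounded interval.
-/
theorem integrable_setIntegral_Iio_indicator {v : ℝ → ℝ} (hv : Integrable v) (a b : ℝ) :
    Integrable ((Ioo a b).indicator fun z => ∫ y in Iio z, v y) := by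
  have hfin : Integrable ((Ioo a b).indicator fun _ => (1 : ℝ)) :=
    (integrable_indicator_iff measurableSet_Ioo).2 (integrableOn_const (by simp))
  have h := integrable_integral_mul_kernel hv
    (κ := fun y z => (Ioi y).indicator ((Ioo a b).indicator fun _ => (1 : ℝ)) z)
    (C := ∫ z, ‖(Ioo a b).indicator (fun _ => (1 : ℝ)) z‖) (by
      have : (Function.uncurry fun y z : ℝ =>
          (Ioi y).indicator ((Ioo a b).indicator fun _ => (1 : ℝ)) z) =
          {q : ℝ × ℝ | q.1 < q.2}.indicator
            (fun q => (Ioo a b).indicator (fun _ => (1 : ℝ)) q.2) := rfl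
      rw [this]
      exact ((measurable_const.indicator measurableSet_Ioo).comp measurable_snd).indicator
        (measurableSet_lt measurable_fst measurable_snd))
    (fun y => ⟨hfin.indicator measurableSet_Ioi, integral_mono
      (hfin.indicator measurableSet_Ioi).norm hfin.norm fun z => norm_indicator_le_norm_self _ _⟩)
  refine h.congr (Filter.Eventually.of_forall fun z => ?_)
  simp only
  by_cases hz : z ∈ Ioo a b
  · rw [indicator_of_mem hz, ← integral_indicator measurableSet_Iio]
    refine integral_congr_ae (Filter.Eventually.of_forall fun y => ?_)
    simp only
    by_cases hy : y < z
    · rw [indicator_of_mem (s := Ioi y) hy, indicator_of_mem hz,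
        indicator_of_mem (s := Iio z) hy, mul_one]
    · rw [indicator_of_notMem (s := Ioi y) hy, indicator_of_notMem (s := Iio z) hy, mul_zero]
  · rw [indicator_of_notMem hz]
    have : ∀ y, (Ioi y).indicator ((Ioo a b).indicator fun _ => (1 : ℝ)) z = 0 := fun y => by
      by_cases hy : y < z
      · rw [indicator_of_mem (s := Ioi y) hy, indicator_of_notMem hz]
      · rw [indicator_of_notMem (s := Ioi y) hy]
    simp only [this, mul_zero, integral_zero]

/-- For -1 < e the power is not integrable at infinity; the indicator in the second variable
restores the uniform bound on sections that Fubini needs. -/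
theorem integrable_mul_indicator_mul_posPow {e : ℝ} (he : -1 < e) (he0 : e ≤ 0)
    {v : ℝ → ℝ} (hv : Integrable v) (a b : ℝ) :
    Integrable (fun q : ℝ × ℝ => v q.1 * ((Ioo a b).indicator (fun _ => (1 : ℝ)) q.2 *
      posPow e (q.2 - q.1))) (volume.prod volume) := by
  have hfin : Integrable ((Ioo a b).indicator fun _ => (1 : ℝ)) :=
    (integrable_indicator_iff measurableSet_Ioo).2 (integrableOn_const (by simp))
  obtain ⟨C, hC⟩ := exists_bound_integral_mul_posPow (M := 1) he he0 hfin (fun z =>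
    (norm_indicator_le_norm_self _ _).trans (by simp))
  exact integrable_mul_kernel hv
    (κ := fun y x => (Ioo a b).indicator (fun _ => (1 : ℝ)) x * posPow e (x - y))
    (((measurable_const.indicator measurableSet_Ioo).comp measurable_snd).mul
      ((measurable_posPow _).comp (measurable_snd.sub measurable_fst))) hC

theorem ae_integrable_mul_posPow {e : ℝ} (he : -1 < e) (he0 : e ≤ 0)
    {v : ℝ → ℝ} (hv : Integrable v) (a b : ℝ) :
    ∀ᵐ x, x ∈ Ioo a b → Integrable fun y => v y * posPow e (x - y) := by
  filter_upwards [(integrable_mul_indicator_mul_posPow he he0 hv a b).prod_left_ae] with x hx hxI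
  simpa only [indicator_of_mem hxI, one_mul] using hx

theorem integrable_integral_mul_posPow_indicator {e : ℝ} (he : -1 < e) (he0 : e ≤ 0)
    {v : ℝ → ℝ} (hv : Integrable v) (a b : ℝ) :
    Integrable ((Ioo a b).indicator fun x => ∫ y, v y * posPow e (x - y)) := by
  refine (integrable_mul_indicator_mul_posPow he he0 hv a b).integral_prod_right.congr
    (Filter.Eventually.of_forall fun x => ?_)
  simp only
  by_cases hx : x ∈ Ioo a b
  · simp only [indicator_of_mem hx, one_mul]
  · simp only [indicator_of_notMem hx, zero_mul, mul_zero, integral_zero]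

/-- The fractional integral of order `1 - α` of `u` has `v` as its derivative, and no constant of
integration appears if `u` is small near the left end point. -/
theorem ae_integral_mul_posPow_eq_setIntegral {α a b r Λ : ℝ} (h0 : 0 < α) (h1 : α < 1)
    (hab : a < b) {u v : ℝ → ℝ} (hu : Integrable u) (hv : Integrable v)
    (hua : ∀ x ≤ a, u x = 0) (hva : ∀ x ≤ a, v x = 0) (hr : r < 1 - α)
    (hΛ : ∀ ε, 0 < ε → ε < b - a → ∫ x in Ioo a (a + ε), ‖u x‖ ≤ Λ * ε ^ (1 - r))
    (hw : ∀ φ : ℝ → ℝ, ContDiff ℝ ∞ φ → HasCompactSupport φ → tsupport φ ⊆ Ioo a b →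
      ∫ x, v x * φ x = ∫ x, u x * rightRLDeriv α φ x) :
    ∀ᵐ z, z ∈ Ioo a b →
      (Real.Gamma (1 - α))⁻¹ * ∫ x, u x * posPow (-α) (z - x) = ∫ y in Iio z, v y := by
  have hG : 0 < (Real.Gamma (1 - α))⁻¹ := inv_pos.2 (Real.Gamma_pos_of_pos (by linarith))
  set γ := (Real.Gamma (1 - α))⁻¹ with hγ
  set U : ℝ → ℝ := fun z => ∫ x, u x * posPow (-α) (z - x) with hU
  set V : ℝ → ℝ := fun z => ∫ y in Iio z, v y with hV
  set D : ℝ → ℝ := fun z => γ * (Ioo a b).indicator U z - (Ioo a b).indicator V z with hD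
  have hUi : Integrable ((Ioo a b).indicator U) :=
    integrable_integral_mul_posPow_indicator (by linarith) (by linarith) hu a b
  have hVi : Integrable ((Ioo a b).indicator V) := integrable_setIntegral_Iio_indicator hv a b
  have hDi : Integrable D := (hUi.const_mul γ).sub hVi
  obtain ⟨c, hc⟩ := exists_ae_eq_const_of_integral_mul_deriv_eq_zero hab hDi
    (fun φ hφ hφc hφs => by
      have hdc : Continuous (deriv φ) := hφ.continuous_deriv (by simp)
      obtain ⟨M, hM⟩ := hdc.bounded_above_of_compact_support hφc.deriv
      have hbd : ∀ F : ℝ → ℝ, Integrable F → Integrable (fun z => F z * deriv φ z) := fun F hF =>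
        hF.mul_bdd (c := M) hdc.aestronglyMeasurable (Filter.Eventually.of_forall hM)
      have hdz : ∀ z, z ∉ Ioo a b → deriv φ z = 0 := fun z hz =>
        image_eq_zero_of_notMem_tsupport fun h => hz (hφs (tsupport_deriv_subset h))
      have e1 := hw φ hφ hφc hφs
      rw [integral_mul_eq_neg_integral_deriv_mul hv hφ hφc,
        integral_mul_rightRLDeriv h0 h1 hu hφ hφc, neg_inj] at e1
      have e2 : ∀ F : ℝ → ℝ, ∀ z, (Ioo a b).indicator F z * deriv φ z = deriv φ z * F z := by
        intro F z
        by_cases hz : z ∈ Ioo a b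
        · rw [indicator_of_mem hz, mul_comm]
        · rw [indicator_of_notMem hz, hdz z hz]; simp
      have e3 : ∀ z, D z * deriv φ z = γ * ((Ioo a b).indicator U z * deriv φ z) -
          (Ioo a b).indicator V z * deriv φ z := fun z => by simp only [hD]; ring
      simp only [e3]
      rw [integral_sub ((hbd _ hUi).const_mul γ) (hbd _ hVi), integral_const_mul]
      simp only [e2]
      rw [e1, ← integral_const_mul, sub_eq_zero]
      refine integral_congr_ae (Filter.Eventually.of_forall fun z => ?_)
      simp only [hU]
      ring)
  -- Averages the a.e. identity c = γ U - V over (a, a + ε). The two smallness estimates contribute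
  -- ε^(1 - α) and ε^(1 - r); after division by the length ε, the exponent 1 - α - r is still
  -- positive.
  have hbound : ∀ ε, 0 < ε → ε < b - a →
      |c| ≤ γ * Λ / (1 - α) * ε ^ (1 - α - r) + ∫ y in a..(a + ε), ‖v y‖ := by
    intro ε he heb
    set I := Ioo a (a + ε) with hI
    have hIab : I ⊆ Ioo a b := Ioo_subset_Ioo_right (by linarith)
    have hvol : volume.real I = ε := by
      rw [hI, Real.volume_real_Ioo_of_le (by linarith)]; ring
    have hUI : IntegrableOn U I :=
      ((integrable_indicator_iff measurableSet_Ioo).1 hUi).mono_set hIab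
    have hpt : ∀ᵐ z ∂volume.restrict I, |c| ≤ γ * ‖U z‖ + ∫ y in a..(a + ε), ‖v y‖ := by
      filter_upwards [ae_restrict_mem measurableSet_Ioo, ae_restrict_of_ae hc] with z hz hcz
      have hcz := hcz (hIab hz)
      simp only [hD, indicator_of_mem (hIab hz)] at hcz
      have hVz : |V z| ≤ ∫ y in a..(a + ε), ‖v y‖ := by
        rw [intervalIntegral.integral_of_le (by linarith)]
        refine (norm_integral_le_integral_norm (μ := volume.restrict (Iio z)) v).trans ?_
        rw [← integral_indicator measurableSet_Iio, ← integral_indicator measurableSet_Ioc]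
        refine integral_mono (hv.norm.indicator measurableSet_Iio)
          (hv.norm.indicator measurableSet_Ioc) fun y => ?_
        rcases le_or_gt y a with hy | hy
        · refine le_of_eq_of_le ?_ (indicator_nonneg (fun _ _ => norm_nonneg _) y)
          refine indicator_apply_eq_zero.2 fun _ => ?_
          rw [hva y hy, norm_zero]
        · by_cases hyz : y < z
          · rw [indicator_of_mem (s := Iio z) hyz,
              indicator_of_mem (s := Ioc a (a + ε)) (mem_Ioc.2 ⟨hy, (hyz.trans hz.2).le⟩)]
          · rw [indicator_of_notMem (s := Iio z) hyz]
            exact indicator_nonneg (fun _ _ => norm_nonneg _) y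
      calc |c| = |γ * U z - V z| := by rw [hcz]
        _ ≤ |γ * U z| + |V z| := abs_sub _ _
        _ ≤ _ := by rw [abs_mul, abs_of_pos hG]; exact add_le_add le_rfl hVz
    set W := ∫ y in a..(a + ε), ‖v y‖ with hW
    have hconst : ∀ d : ℝ, Integrable (fun _ : ℝ => d) (volume.restrict I) := fun d =>
      integrableOn_const (by simp [hI])
    have hmono := integral_mono_ae (hconst |c|) ((hUI.norm.const_mul γ).add (hconst W)) hpt
    simp only [Pi.add_apply] at hmono
    rw [setIntegral_const, integral_add (hUI.norm.const_mul γ) (hconst W),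
      integral_const_mul, setIntegral_const, hvol, smul_eq_mul, smul_eq_mul] at hmono
    have hUle := (setIntegral_norm_integral_mul_posPow_le h1 hu he hua).trans
      (mul_le_mul_of_nonneg_left (hΛ ε he heb)
        (div_nonneg (Real.rpow_nonneg he.le _) (by linarith)))
    have h3 : ε * |c| ≤ ε * (γ * Λ / (1 - α) * ε ^ (1 - α - r) + W) := by
      have e5 : ε ^ (1 - α) * ε ^ (1 - r) = ε * ε ^ (1 - α - r) := by
        rw [← Real.rpow_add he, show 1 - α + (1 - r) = 1 + (1 - α - r) by ring,
          Real.rpow_add he, Real.rpow_one]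
      calc ε * |c| ≤ γ * (ε ^ (1 - α) / (1 - α) * (Λ * ε ^ (1 - r))) + ε * W :=
            hmono.trans (add_le_add (mul_le_mul_of_nonneg_left hUle hG.le) le_rfl)
        _ = γ * Λ / (1 - α) * (ε ^ (1 - α) * ε ^ (1 - r)) + ε * W := by ring
        _ = _ := by rw [e5]; ring
    exact le_of_mul_le_mul_left h3 he
  have hlim : Filter.Tendsto (fun ε : ℝ => γ * Λ / (1 - α) * ε ^ (1 - α - r) +
      ∫ y in a..(a + ε), ‖v y‖) (nhdsWithin 0 (Ioi 0)) (nhds 0) := by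
    have t1 : Filter.Tendsto (fun ε : ℝ => ε ^ (1 - α - r)) (nhds 0) (nhds 0) := by
      have := (Real.continuousAt_rpow_const 0 (1 - α - r) (Or.inr (by linarith))).tendsto
      rwa [Real.zero_rpow (by linarith)] at this
    have t2 : Filter.Tendsto (fun ε : ℝ => ∫ y in a..(a + ε), ‖v y‖) (nhds 0) (nhds 0) := by
      have hcont : Continuous fun ε : ℝ => ∫ y in a..(a + ε), ‖v y‖ :=
        (intervalIntegral.continuous_primitive (fun _ _ => hv.norm.intervalIntegrable) a).comp
          (continuous_const.add continuous_id)
      have := hcont.tendsto 0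
      simpa using this
    have := (t1.const_mul (γ * Λ / (1 - α))).add t2
    rw [mul_zero, add_zero] at this
    exact this.mono_left nhdsWithin_le_nhds
  have hc0 : c = 0 := by
    refine abs_nonpos_iff.1 (ge_of_tendsto hlim ?_)
    filter_upwards [Ioo_mem_nhdsGT (sub_pos.2 hab)] with ε hε
    exact hbound ε hε.1 hε.2
  filter_upwards [hc] with z hz hzI
  have := hz hzI
  simp only [hD, indicator_of_mem hzI, hc0] at this
  exact sub_eq_zero.1 this

/-! ### Inversion of the fractional derivative -/

/-- Inversion of the fractional derivative on an interval. -/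
theorem ae_eq_indicator_integral_mul_posPow {α a b : ℝ} (h0 : 0 < α) (h1 : α < 1)
    {u v : ℝ → ℝ} (hu : Integrable u) (hv : Integrable v)
    (hua : ∀ x ∉ Ioo a b, u x = 0) (hva : ∀ x ≤ a, v x = 0)
    (hUV : ∀ᵐ z, z ∈ Ioo a b →
      (Real.Gamma (1 - α))⁻¹ * ∫ x, u x * posPow (-α) (z - x) = ∫ y in Iio z, v y) :
    u =ᵐ[volume] (Ioo a b).indicator fun x =>
      Real.Gamma (1 - α) / betaConst α * ∫ y, v y * posPow (α - 1) (x - y) := by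
  have hG : 0 < Real.Gamma (1 - α) := Real.Gamma_pos_of_pos (by linarith)
  have hB := betaConst_pos h0 h1
  set κ := Real.Gamma (1 - α) / betaConst α with hκ
  set H : ℝ → ℝ := fun x => ∫ y, v y * posPow (α - 1) (x - y) with hH
  set h : ℝ → ℝ := (Ioo a b).indicator fun x => κ * H x with hh
  have hhi : Integrable h := by
    have := (integrable_integral_mul_posPow_indicator (e := α - 1) (by linarith) (by linarith)
      hv a b).const_mul κ
    refine this.congr (Filter.Eventually.of_forall fun x => ?_)
    simp only [hh, indicator_const_mul, hH]
  set P : ℝ → ℝ := fun x => u x - h x with hP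
  have hPi : Integrable P := hu.sub hhi
  have hPz : ∀ x ∉ Ioo a b, P x = 0 := fun x hx => by
    simp only [hP, hh, indicator_of_notMem hx, hua x hx, sub_zero]
  have hloc : ∀ f : ℝ → ℝ, Integrable f →
      ∀ᵐ z, z ∈ Ioo a b → Integrable fun x => f x * posPow (-α) (z - x) := fun f hf =>
    ae_integrable_mul_posPow (by linarith) (by linarith) hf a b
  have hH0 : ∀ x ≤ a, H x = 0 := by
    intro x hx
    simp only [hH]
    refine integral_eq_zero_of_ae (Filter.Eventually.of_forall fun y => ?_)
    rcases le_or_gt y a with hy | hy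
    · simp [hva y hy]
    · simp [posPow_of_nonpos (show x - y ≤ 0 by linarith)]
  -- The difference P of the two sides is annihilated on (a, b) by the fractional integral of order
  -- 1 - α, since u and h have the same one there.
  have hPk : ∀ᵐ z, z ∈ Ioo a b → ∫ x, P x * posPow (-α) (z - x) = 0 := by
    filter_upwards [hUV, hloc u hu, hloc h hhi] with z hz iu ih hzI
    have e1 : ∫ x, h x * posPow (-α) (z - x) = κ * (betaConst α * ∫ y in Iio z, v y) := by
      rw [← integral_posPow_mul_integral h0 h1 hv z, ← integral_const_mul]
      refine integral_congr_ae (Filter.Eventually.of_forall fun x => ?_)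
      simp only [hh]
      by_cases hx : x ∈ Ioo a b
      · rw [indicator_of_mem hx]; simp only [hH]; ring
      · rw [indicator_of_notMem hx, zero_mul]
        rcases le_or_gt x a with hxa | hxa
        · have := hH0 x hxa
          simp only [hH] at this
          rw [this]; ring
        · have : b ≤ x := not_lt.1 fun h3 => hx ⟨hxa, h3⟩
          rw [posPow_of_nonpos (by linarith [hzI.2])]; ring
    have e2 := hz hzI
    simp only [hP, sub_mul]
    rw [integral_sub (iu hzI) (ih hzI), e1, ← e2, hκ]
    field_simp
    ring
  -- The composition formula with 1 - α in place of α: a fractional integral of order α turns the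
  -- vanishing fractional integral of P into a multiple of its primitive. Values of z beyond b add
  -- nothing because P vanishes there.
  have hzero : ∀ z ≤ b, ∫ x in Iio z, P x = 0 := by
    intro z hz
    have key := integral_posPow_mul_integral (α := 1 - α) (by linarith) (by linarith) hPi z
    have e4 : ∫ x, posPow (-(1 - α)) (z - x) * ∫ y, P y * posPow (1 - α - 1) (x - y) = 0 := by
      refine integral_eq_zero_of_ae ?_
      filter_upwards [hPk, Measure.ae_ne volume a] with x hx hxa
      rcases lt_or_ge x z with h3 | h3
      · rcases le_or_gt x a with h4 | h4
        · have : ∀ y, P y * posPow (1 - α - 1) (x - y) = 0 := fun y => by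
            rcases le_or_gt y a with hy | hy
            · rw [hPz y (fun h5 => not_lt.2 hy h5.1), zero_mul]
            · rw [posPow_of_nonpos (by linarith), mul_zero]
          simp only [this, integral_zero, mul_zero, Pi.zero_apply]
        · have := hx ⟨h4, by linarith⟩
          rw [show 1 - α - 1 = -α by ring, this]
          simp
      · rw [posPow_of_nonpos (by linarith)]; simp
    rw [e4] at key
    exact (mul_eq_zero.1 key.symm).resolve_left
      (betaConst_pos (α := 1 - α) (by linarith) (by linarith)).ne'
  have hall : ∀ z, ∫ x in Iio z, P x = 0 := by
    intro z
    rcases le_or_gt z b with hz | hz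
    · exact hzero z hz
    · rw [← hzero b le_rfl, ← integral_indicator measurableSet_Iio,
        ← integral_indicator measurableSet_Iio]
      congr 1
      funext x
      by_cases hx : x < b
      · rw [indicator_of_mem (s := Iio z) (show x < z by linarith),
          indicator_of_mem (s := Iio b) hx]
      · rw [indicator_of_notMem (s := Iio b) hx]
        refine indicator_apply_eq_zero.2 fun _ => hPz x fun h5 => hx h5.2
  filter_upwards [ae_eq_zero_of_setIntegral_Iio_eq_zero hPi hall] with x hx
  exact sub_eq_zero.1 hx

/-! ### The fractional derivative of the extension by zero -/

/-- The left fractional derivative of the extension by zero past `b` of a function whose left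
fractional derivative on `(-∞, b)` is `v`. -/
def extensionDeriv (α b : ℝ) (v : ℝ → ℝ) (s : ℝ) : ℝ :=
  v s - (betaConst α)⁻¹ * ∫ y, v y * hardyKernel α b y s

theorem integrable_integral_mul_hardyKernel {α : ℝ} (h0 : 0 < α) (h1 : α < 1) (b : ℝ)
    {v : ℝ → ℝ} (hv : Integrable v) : Integrable fun s => ∫ y, v y * hardyKernel α b y s :=
  integrable_integral_mul_kernel hv (measurable_hardyKernel α b)
    (integral_norm_hardyKernel_le h0 h1 b)

theorem integrable_extensionDeriv {α : ℝ} (h0 : 0 < α) (h1 : α < 1) (b : ℝ)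
    {v : ℝ → ℝ} (hv : Integrable v) : Integrable (extensionDeriv α b v) :=
  hv.sub ((integrable_integral_mul_hardyKernel h0 h1 b hv).const_mul _)

theorem setIntegral_Ioi_integral_mul_hardyKernel {α : ℝ} (h0 : 0 < α) (h1 : α < 1) (b z : ℝ)
    {v : ℝ → ℝ} (hv : Integrable v) :
    ∫ s in Ioi z, ∫ y, v y * hardyKernel α b y s = ∫ y, v y * ∫ s in Ioi z, hardyKernel α b y s := by
  have h := integral_mul_kernel_swap hv
    (κ := fun y s => (Ioi z).indicator (hardyKernel α b y) s) (C := betaConst α)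
    (by
      have : (Function.uncurry fun y s : ℝ => (Ioi z).indicator (hardyKernel α b y) s) =
          ((fun q : ℝ × ℝ => q.2) ⁻¹' Ioi z).indicator (Function.uncurry (hardyKernel α b)) := rfl
      rw [this]
      exact (measurable_hardyKernel α b).indicator (measurable_snd measurableSet_Ioi))
    (fun y => by
      obtain ⟨hi, hn⟩ := integral_norm_hardyKernel_le h0 h1 b y
      exact ⟨hi.indicator measurableSet_Ioi, (integral_mono
        (hi.indicator measurableSet_Ioi).norm hi.norm
        fun s => norm_indicator_le_norm_self _ _).trans hn⟩)
  simp only [integral_indicator measurableSet_Ioi] at h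
  rw [← h, ← integral_indicator measurableSet_Ioi]
  refine integral_congr_ae (Filter.Eventually.of_forall fun s => ?_)
  simp only
  by_cases hs : s ∈ Ioi z
  · simp only [indicator_of_mem hs]
  · simp only [indicator_of_notMem hs, mul_zero, integral_zero]

/-- For z < b the cut-off at b is invisible and the composition formula gives the primitive of v.
For z ≥ b the left side is B⁻¹ times the integral of T over (z, ∞), where B is `betaConst α`. Since
T has total integral B ∫ v, that tail is what remains of ∫ v after subtracting B⁻¹ ∫ T over (-∞, z).
-/
theorem integral_mul_posPow_eq_setIntegral_extensionDeriv {α a b : ℝ} (h0 : 0 < α) (h1 : α < 1)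
    {u v : ℝ → ℝ} (hv : Integrable v) (hva : ∀ x ∉ Ioo a b, v x = 0)
    (huv : u =ᵐ[volume] (Ioo a b).indicator fun x =>
      Real.Gamma (1 - α) / betaConst α * ∫ y, v y * posPow (α - 1) (x - y)) (z : ℝ) :
    (Real.Gamma (1 - α))⁻¹ * ∫ x, u x * posPow (-α) (z - x) =
      ∫ s in Iio z, extensionDeriv α b v s := by
  have hG : 0 < Real.Gamma (1 - α) := Real.Gamma_pos_of_pos (by linarith)
  have hB := betaConst_pos h0 h1
  set H : ℝ → ℝ := fun x => ∫ y, v y * posPow (α - 1) (x - y) with hH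
  set T : ℝ → ℝ := fun s => ∫ y, v y * hardyKernel α b y s with hT
  have hTi : Integrable T := integrable_integral_mul_hardyKernel h0 h1 b hv
  have hH0 : ∀ x ≤ a, H x = 0 := by
    intro x hx
    simp only [hH]
    refine integral_eq_zero_of_ae (Filter.Eventually.of_forall fun y => ?_)
    rcases le_or_gt y a with hy | hy
    · simp [hva y (fun h => not_lt.2 hy h.1)]
    · simp [posPow_of_nonpos (show x - y ≤ 0 by linarith)]
  have hL : (Real.Gamma (1 - α))⁻¹ * ∫ x, u x * posPow (-α) (z - x) =
      (betaConst α)⁻¹ * ∫ x in Iio b, posPow (-α) (z - x) * H x := by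
    rw [← integral_indicator measurableSet_Iio, ← integral_const_mul, ← integral_const_mul]
    refine integral_congr_ae ?_
    filter_upwards [huv] with x hx
    rw [hx]
    by_cases hxb : x < b
    · rw [indicator_of_mem (s := Iio b) hxb]
      rcases le_or_gt x a with hxa | hxa
      · rw [indicator_of_notMem (fun h => not_lt.2 hxa h.1), hH0 x hxa]
        ring
      · rw [indicator_of_mem (mem_Ioo.2 ⟨hxa, hxb⟩)]
        simp only [hH]
        field_simp
    · rw [indicator_of_notMem (s := Iio b) hxb, indicator_of_notMem (fun h => hxb h.2)]
      ring
  have hR : ∫ s in Iio z, extensionDeriv α b v s =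
      (∫ s in Iio z, v s) - (betaConst α)⁻¹ * ∫ s in Iio z, T s := by
    simp only [extensionDeriv]
    rw [integral_sub hv.integrableOn (hTi.integrableOn.const_mul _), integral_const_mul]
  rw [hL, hR]
  rcases lt_or_ge z b with hz | hz
  · have e1 : ∫ x in Iio b, posPow (-α) (z - x) * H x = betaConst α * ∫ y in Iio z, v y := by
      rw [← integral_posPow_mul_integral h0 h1 hv z]
      refine setIntegral_eq_integral_of_forall_compl_eq_zero fun x hx => ?_
      have : b ≤ x := not_lt.1 hx
      rw [posPow_of_nonpos (by linarith), zero_mul]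
    have e2 : ∫ s in Iio z, T s = 0 := by
      refine setIntegral_eq_zero_of_forall_eq_zero fun s hs => ?_
      have hs : s < z := hs
      simp only [hT, hardyKernel_of_le_right (show s ≤ b by linarith), mul_zero, integral_zero]
    rw [e1, e2, inv_mul_cancel_left₀ hB.ne']
    ring
  · have e1 : ∫ x in Iio b, posPow (-α) (z - x) * H x = ∫ s in Ioi z, T s := by
      rw [setIntegral_Ioi_integral_mul_hardyKernel h0 h1 b z hv]
      exact integral_Iio_posPow_mul_integral h0 h1 hv hz
    have e2 : ∫ s in Iio z, v s = ∫ s, v s :=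
      setIntegral_eq_integral_of_forall_compl_eq_zero fun s hs =>
        hva s fun h => hs (h.2.trans_le hz)
    have e3 : ∫ s, T s = betaConst α * ∫ s, v s := by
      have e4 : ∫ s, T s = ∫ s in Ioi b, T s :=
        (setIntegral_eq_integral_of_forall_compl_eq_zero fun s hs => by
          simp only [hT, hardyKernel_of_le_right (not_lt.1 hs), mul_zero, integral_zero]).symm
      rw [e4, setIntegral_Ioi_integral_mul_hardyKernel h0 h1 b b hv, ← integral_const_mul]
      refine integral_congr_ae (Filter.Eventually.of_forall fun y => ?_)
      simp only
      rw [setIntegral_Ioi_hardyKernel_self h0 h1]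
      by_cases hy : y ∈ Iio b
      · rw [indicator_of_mem hy, mul_comm]
      · rw [hva y fun h => hy h.2]; ring
    have e5 : ∫ s in Iio z, T s = (∫ s, T s) - ∫ s in Ioi z, T s := by
      have := integral_add_compl (measurableSet_Iio (a := z)) hTi
      rw [compl_Iio, integral_Ici_eq_integral_Ioi] at this
      linarith
    rw [e1, e5, e2, e3]
    field_simp
    ring

theorem isWeakFracDeriv_left_univ {α : ℝ} (h0 : 0 < α) (h1 : α < 1) {u w : ℝ → ℝ}
    (hu : Integrable u) (hw : Integrable w)
    (h : ∀ z, (Real.Gamma (1 - α))⁻¹ * ∫ x, u x * posPow (-α) (z - x) = ∫ s in Iio z, w s) :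
    IsWeakFracDeriv Side.left α univ u w where
  integrableOn := hu.integrableOn
  locallyIntegrableOn := hw.locallyIntegrable.locallyIntegrableOn _
  integral_eq φ hφ hc _ := by
    simp only [Measure.restrict_univ, dualRLDeriv]
    rw [integral_mul_rightRLDeriv h0 h1 hu hφ hc, integral_mul_eq_neg_integral_deriv_mul hw hφ hc]
    simp only [h]

/-! ### The Hardy type inequality in L^p -/

theorem lintegral_rpow_le_measure_univ_rpow_mul {β : Type*} [MeasurableSpace β] {ν : Measure β}
    {p : ℝ} (hp : 1 ≤ p) {F : β → ℝ≥0∞} (hF : AEMeasurable F ν) :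
    (∫⁻ t, F t ∂ν) ^ p ≤ ν univ ^ (p - 1) * ∫⁻ t, F t ^ p ∂ν := by
  have hp0 : 0 < p := by linarith
  have h := eLpNorm'_le_eLpNorm'_mul_rpow_measure_univ (p := 1) (q := p) zero_lt_one hp
    hF.aestronglyMeasurable
  simp only [eLpNorm', enorm_eq_self, ENNReal.rpow_one, div_one] at h
  have h2 := ENNReal.rpow_le_rpow h hp0.le
  rwa [ENNReal.mul_rpow_of_nonneg _ _ hp0.le, ← ENNReal.rpow_mul, ← ENNReal.rpow_mul,
    one_div_mul_cancel hp0.ne', ENNReal.rpow_one, sub_mul, one_div_mul_cancel hp0.ne', one_mul,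
    mul_comm] at h2

theorem lintegral_Ioi_comp_const_sub_mul {b c t : ℝ} (ht : 0 < t) (V : ℝ → ℝ≥0∞) :
    ∫⁻ s in Ioi c, ENNReal.ofReal t * V (b - (s - c) * t) = ∫⁻ y in Iio b, V y := by
  have himg : (fun s => b - (s - c) * t) '' Ioi c = Iio b := by
    ext y
    simp only [mem_image, mem_Ioi, mem_Iio]
    constructor
    · rintro ⟨s, hs, rfl⟩
      have := mul_pos (sub_pos.2 hs) ht
      linarith
    · intro hy
      refine ⟨c + (b - y) / t, ?_, ?_⟩
      · have := div_pos (sub_pos.2 hy) ht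
        linarith
      · field_simp
        ring
  have hder : ∀ s ∈ Ioi c, HasDerivWithinAt (fun s => b - (s - c) * t) ((fun _ => -t) s)
      (Ioi c) s := by
    intro s _
    have := ((((hasDerivAt_id s).sub_const c).mul_const t).const_sub b).hasDerivWithinAt
      (s := Ioi c)
    simpa using this
  have hinj : InjOn (fun s => b - (s - c) * t) (Ioi c) := by
    intro s _ s' _ h
    simp only at h
    have h3 : (s - c) * t = (s' - c) * t := by linarith
    have := mul_right_cancel₀ ht.ne' h3
    linarith
  rw [← himg, lintegral_image_eq_lintegral_abs_deriv_mul measurableSet_Ioi hder hinj]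
  simp only [abs_neg, abs_of_pos ht]

/-- A Hardy type inequality for `hardyKernel`. -/
theorem lintegral_rpow_lintegral_mul_hardyKernel_le {α p : ℝ} (hp : 1 ≤ p) (b : ℝ)
    {V : ℝ → ℝ≥0∞} (hV : Measurable V) :
    ∫⁻ s in Ioi b, (∫⁻ y, V y * ENNReal.ofReal (hardyKernel α b y s)) ^ p ≤
      (∫⁻ t in Ioi (0 : ℝ), ENNReal.ofReal (t ^ (α - 1 / p) / (1 + t))) ^ p *
        ∫⁻ y, V y ^ p := by
  have hp0 : 0 < p := by linarith
  set ρ : ℝ → ℝ≥0∞ := fun t => ENNReal.ofReal (t ^ (α - 1 / p) / (1 + t)) with hρ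
  have hρm : Measurable ρ := by simp only [hρ]; fun_prop
  set M := ∫⁻ t in Ioi (0 : ℝ), ρ t with hM
  -- The term `t - 0` matches the form of `lintegral_Ioi_comp_const_sub_mul` at c = 0. The factor
  -- t^(1/p) is kept apart from ρ so that its p-th power is t, the Jacobian of s ↦ b - (s - b) t
  -- needed later.
  set F : ℝ → ℝ → ℝ≥0∞ := fun s t => V (b - (t - 0) * (s - b)) * ENNReal.ofReal (t ^ (1 / p))
    with hF
  have hFm : ∀ s, Measurable (F s) := fun s => by
    simp only [hF]
    exact (hV.comp (by fun_prop)).mul (by fun_prop)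
  -- With y = b - t (s - b) the kernel times the Jacobian becomes t^α/(1 + t) = ρ(t) t^(1/p),
  -- independent of s.
  have hinner : ∀ s ∈ Ioi b, ∫⁻ y, V y * ENNReal.ofReal (hardyKernel α b y s) =
      ∫⁻ t, F s t ∂((volume.restrict (Ioi 0)).withDensity ρ) := by
    intro s hs
    have hs : b < s := hs
    have hσ : 0 < s - b := sub_pos.2 hs
    rw [lintegral_withDensity_eq_lintegral_mul _ hρm (hFm s)]
    have e1 : ∫⁻ y, V y * ENNReal.ofReal (hardyKernel α b y s) =
        ∫⁻ y in Iio b, V y * ENNReal.ofReal (hardyKernel α b y s) := by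
      rw [← lintegral_indicator measurableSet_Iio]
      refine lintegral_congr fun y => ?_
      by_cases hy : y < b
      · rw [indicator_of_mem (s := Iio b) hy]
      · rw [indicator_of_notMem (s := Iio b) hy, hardyKernel_of_le_left (not_lt.1 hy)]
        simp
    rw [e1, ← lintegral_Ioi_comp_const_sub_mul (c := 0) hσ]
    refine setLIntegral_congr_fun measurableSet_Ioi fun t ht => ?_
    have ht : (0 : ℝ) < t := ht
    have hts : 0 < t * (s - b) := mul_pos ht hσ
    simp only [Pi.mul_apply, hF, hρ, sub_zero]
    rw [hardyKernel_of_lt (by linarith) hs, mul_left_comm, ← ENNReal.ofReal_mul hσ.le,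
      mul_comm (ENNReal.ofReal (t ^ (α - 1 / p) / (1 + t))), mul_assoc,
      ← ENNReal.ofReal_mul (by positivity)]
    congr 2
    rw [show b - (b - t * (s - b)) = t * (s - b) by ring,
      show s - (b - t * (s - b)) = (s - b) * (1 + t) by ring, Real.mul_rpow ht.le hσ.le,
      Real.rpow_neg hσ.le, Real.rpow_sub ht]
    have h3 : (s - b) ^ α ≠ 0 := (Real.rpow_pos_of_pos hσ _).ne'
    have h4 : t ^ (1 / p) ≠ 0 := (Real.rpow_pos_of_pos ht _).ne'
    field_simp
  have huniv : ((volume.restrict (Ioi 0)).withDensity ρ) univ = M := by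
    rw [withDensity_apply _ MeasurableSet.univ, Measure.restrict_univ]
  have hG : Measurable (Function.uncurry fun s t : ℝ =>
      ρ t * (ENNReal.ofReal t * V (b - (s - b) * t) ^ p)) := by
    refine (hρm.comp measurable_snd).mul ((by fun_prop : Measurable fun q : ℝ × ℝ =>
      ENNReal.ofReal q.2).mul ((hV.comp (by fun_prop)).pow_const p))
  calc ∫⁻ s in Ioi b, (∫⁻ y, V y * ENNReal.ofReal (hardyKernel α b y s)) ^ p
      ≤ ∫⁻ s in Ioi b, M ^ (p - 1) *
          ∫⁻ t in Ioi (0 : ℝ), ρ t * (ENNReal.ofReal t * V (b - (s - b) * t) ^ p) := by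
        refine setLIntegral_mono' measurableSet_Ioi fun s hs => ?_
        rw [hinner s hs]
        -- Jensen's inequality for the measure ρ dt of total mass M; this costs M^(p - 1), and
        -- integrating out t at the end supplies the last factor M.
        refine (lintegral_rpow_le_measure_univ_rpow_mul hp (hFm s).aemeasurable).trans ?_
        rw [huniv, lintegral_withDensity_eq_lintegral_mul _ hρm ((hFm s).pow_const p)]
        refine mul_le_mul_right (le_of_eq ?_) _
        refine setLIntegral_congr_fun measurableSet_Ioi fun t ht => ?_
        have ht : (0 : ℝ) < t := ht
        simp only [Pi.mul_apply, hF, sub_zero]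
        rw [ENNReal.mul_rpow_of_nonneg _ _ hp0.le,
          ENNReal.ofReal_rpow_of_pos (Real.rpow_pos_of_pos ht _), ← Real.rpow_mul ht.le,
          one_div_mul_cancel hp0.ne', Real.rpow_one, mul_comm t (s - b),
          mul_comm (V _ ^ p)]
    _ = M ^ (p - 1) * ∫⁻ t in Ioi (0 : ℝ), ∫⁻ s in Ioi b,
          ρ t * (ENNReal.ofReal t * V (b - (s - b) * t) ^ p) := by
        rw [← lintegral_lintegral_swap hG.aemeasurable]
        exact lintegral_const_mul _ hG.lintegral_prod_right'
    _ = M ^ (p - 1) * ∫⁻ t in Ioi (0 : ℝ), ρ t * ∫⁻ y in Iio b, V y ^ p := by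
        congr 1
        refine setLIntegral_congr_fun measurableSet_Ioi fun t ht => ?_
        rw [lintegral_const_mul' _ _ ENNReal.ofReal_ne_top,
          lintegral_Ioi_comp_const_sub_mul ht fun y => V y ^ p]
    _ = M ^ p * ∫⁻ y in Iio b, V y ^ p := by
        rw [lintegral_mul_const _ hρm, ← mul_assoc]
        congr 1
        rw [← hM]
        nth_rewrite 2 [← ENNReal.rpow_one M]
        rw [← ENNReal.rpow_add_of_nonneg _ _ (by linarith) zero_le_one, sub_add_cancel]
    _ ≤ M ^ p * ∫⁻ y, V y ^ p := mul_le_mul_right (setLIntegral_le_lintegral _ _) _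

/-- The norm of the passage from a fractional derivative to that of the extension by zero. -/
def extensionBound (α p : ℝ) : ℝ≥0∞ :=
  1 + ENNReal.ofReal (betaConst α)⁻¹ *
    ∫⁻ t in Ioi (0 : ℝ), ENNReal.ofReal (t ^ (α - 1 / p) / (1 + t))

/-- The exponent α - 1/p exceeds -1, giving convergence at 0, because p ≥ 1 and α > 0; it is
negative, giving convergence at infinity, because αp < 1. -/
theorem extensionBound_ne_top {α p : ℝ} (h0 : 0 < α) (hp : 1 ≤ p) (hαp : α * p < 1) :
    extensionBound α p ≠ ⊤ := by
  have hp0 : 0 < p := by linarith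
  refine ENNReal.add_ne_top.2 ⟨ENNReal.one_ne_top, ENNReal.mul_ne_top ENNReal.ofReal_ne_top ?_⟩
  have h1 : 1 / p ≤ 1 := (div_le_one hp0).2 hp
  have h2 : α < 1 / p := (lt_div_iff₀ hp0).2 hαp
  have hi := integrableOn_rpow_div_one_add (c := α - 1 / p) (by linarith) (by linarith)
  refine (lt_of_le_of_lt (lintegral_mono fun t => ?_) hi.hasFiniteIntegral).ne
  exact Real.ofReal_le_enorm _

theorem eLpNorm_integral_mul_hardyKernel_le {α p : ℝ} (hp : 1 ≤ p) (b : ℝ) {v : ℝ → ℝ}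
    (hv : AEStronglyMeasurable v volume) :
    eLpNorm (fun s => ∫ y, v y * hardyKernel α b y s) (ENNReal.ofReal p) volume ≤
      (∫⁻ t in Ioi (0 : ℝ), ENNReal.ofReal (t ^ (α - 1 / p) / (1 + t))) *
        eLpNorm v (ENNReal.ofReal p) volume := by
  have hp0 : 0 < p := by linarith
  have hne : ENNReal.ofReal p ≠ 0 := (ENNReal.ofReal_pos.2 hp0).ne'
  -- A strongly measurable representative, since the Hardy inequality is stated for measurable V.
  set V : ℝ → ℝ≥0∞ := fun y => ‖hv.mk v y‖ₑ with hV
  have hVm : Measurable V := hv.stronglyMeasurable_mk.measurable.enorm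
  have hVv : ∀ᵐ y, V y = ‖v y‖ₑ := by
    filter_upwards [hv.ae_eq_mk] with y hy
    simp only [hV, hy]
  rw [eLpNorm_eq_lintegral_rpow_enorm_toReal hne ENNReal.ofReal_ne_top,
    eLpNorm_eq_lintegral_rpow_enorm_toReal hne ENNReal.ofReal_ne_top, ENNReal.toReal_ofReal hp0.le]
  have h := ENNReal.rpow_le_rpow (lintegral_rpow_lintegral_mul_hardyKernel_le (α := α) hp b hVm)
    (one_div_pos.2 hp0).le
  rw [ENNReal.mul_rpow_of_nonneg _ _ (one_div_pos.2 hp0).le, ← ENNReal.rpow_mul,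
    mul_one_div_cancel hp0.ne', ENNReal.rpow_one] at h
  have e1 : ∫⁻ y, V y ^ p = ∫⁻ y, ‖v y‖ₑ ^ p := by
    refine lintegral_congr_ae ?_
    filter_upwards [hVv] with y hy
    rw [hy]
  rw [e1] at h
  refine (ENNReal.rpow_le_rpow ?_ (one_div_pos.2 hp0).le).trans h
  rw [← lintegral_indicator measurableSet_Ioi]
  refine lintegral_mono fun s => ?_
  by_cases hs : s ∈ Ioi b
  · rw [indicator_of_mem hs]
    refine ENNReal.rpow_le_rpow ((enorm_integral_le_lintegral_enorm _).trans (le_of_eq ?_)) hp0.le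
    refine lintegral_congr_ae ?_
    filter_upwards [hVv] with y hy
    rw [enorm_mul, hy, Real.enorm_of_nonneg (hardyKernel_nonneg α b y s)]
  · simp only [hardyKernel_of_le_right (not_lt.1 hs), mul_zero, integral_zero, enorm_zero,
      ENNReal.zero_rpow_of_pos hp0, zero_le]

theorem eLpNorm_extensionDeriv_le {α p : ℝ} (h0 : 0 < α) (h1 : α < 1) (hp : 1 ≤ p) (b : ℝ)
    {v : ℝ → ℝ} (hv : Integrable v) :
    eLpNorm (extensionDeriv α b v) (ENNReal.ofReal p) volume ≤
      extensionBound α p * eLpNorm v (ENNReal.ofReal p) volume := by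
  have hT := integrable_integral_mul_hardyKernel h0 h1 b hv
  have h := eLpNorm_sub_le (p := ENNReal.ofReal p) hv.aestronglyMeasurable
    (hT.aestronglyMeasurable.const_smul (betaConst α)⁻¹)
    (by simpa using ENNReal.ofReal_le_ofReal hp)
  refine h.trans ?_
  rw [eLpNorm_const_smul, extensionBound, add_mul, one_mul,
    Real.enorm_of_nonneg (inv_pos.2 (betaConst_pos h0 h1)).le, mul_assoc]
  gcongr
  exact eLpNorm_integral_mul_hardyKernel_le hp b hv.aestronglyMeasurable

/-! ### Extension by zero of weakly differentiable functions -/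

theorem IsWeakFracDeriv.congr {s : Side} {α : ℝ} {Ω : Set ℝ} {u u' v : ℝ → ℝ}
    (h : IsWeakFracDeriv s α Ω u v) (hu : u =ᵐ[volume.restrict Ω] u') :
    IsWeakFracDeriv s α Ω u' v where
  integrableOn := h.integrableOn.congr hu
  locallyIntegrableOn := h.locallyIntegrableOn
  integral_eq φ hφ hc hs := by
    rw [h.integral_eq φ hφ hc hs]
    refine integral_congr_ae ?_
    filter_upwards [hu] with x hx
    rw [hx]

/-- The extension by zero of a function with a left weak fractional derivative. -/
theorem IsWeakFracDeriv.exists_extension_left {α p q a b : ℝ} (h0 : 0 < α) (h1 : α < 1)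
    (hp : 1 ≤ p) (hq : 1 ≤ q) (hqα : 1 / q < 1 - α) (hab : a < b) {u v : ℝ → ℝ}
    (h : IsWeakFracDeriv Side.left α (Ioo a b) u v)
    (hv : MemLp v (ENNReal.ofReal p) (volume.restrict (Ioo a b)))
    (hu : MemLp u (ENNReal.ofReal q) (volume.restrict (Ioo a b))) :
    ∃ w, IsWeakFracDeriv Side.left α univ ((Ioo a b).indicator u) w ∧
      AEStronglyMeasurable w volume ∧
      eLpNorm w (ENNReal.ofReal p) volume ≤
        extensionBound α p * eLpNorm v (ENNReal.ofReal p) (volume.restrict (Ioo a b)) := by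
  have hp1 : 1 ≤ ENNReal.ofReal p := by simpa using ENNReal.ofReal_le_ofReal hp
  set I := Ioo a b with hI
  have hvi : Integrable (I.indicator v) :=
    (integrable_indicator_iff measurableSet_Ioo).2 (hv.integrable hp1)
  have hui : Integrable (I.indicator u) :=
    (integrable_indicator_iff measurableSet_Ioo).2 h.integrableOn
  have hz : ∀ f : ℝ → ℝ, ∀ x ≤ a, I.indicator f x = 0 := fun f x hx =>
    indicator_of_notMem (fun h => not_lt.2 hx h.1) _
  obtain ⟨Λ, hΛ⟩ := exists_setIntegral_norm_le_rpow hq hu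
  have hUV := ae_integral_mul_posPow_eq_setIntegral (r := 1 / q) (Λ := Λ) h0 h1 hab hui hvi (hz u)
    (hz v) hqα (fun ε he heb => by
      refine le_of_eq_of_le (setIntegral_congr_fun measurableSet_Ioo fun x hx => ?_) (hΛ ε he heb)
      rw [indicator_of_mem (mem_Ioo.2 ⟨hx.1, by linarith [hx.2]⟩)])
    (fun φ hφ hc hs => by
      have e := h.integral_eq φ hφ hc hs
      rw [← integral_indicator measurableSet_Ioo, ← integral_indicator measurableSet_Ioo] at e
      simp only [dualRLDeriv] at e
      simpa only [indicator_mul_left] using e)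
  have hrep := ae_eq_indicator_integral_mul_posPow h0 h1 hui hvi
    (fun x hx => indicator_of_notMem hx _) (hz v) hUV
  refine ⟨extensionDeriv α b (I.indicator v), ?_, ?_, ?_⟩
  · exact isWeakFracDeriv_left_univ h0 h1 hui (integrable_extensionDeriv h0 h1 b hvi)
      (integral_mul_posPow_eq_setIntegral_extensionDeriv h0 h1 hvi
        (fun x hx => indicator_of_notMem hx _) hrep)
  · exact (integrable_extensionDeriv h0 h1 b hvi).aestronglyMeasurable
  · rw [← eLpNorm_indicator_eq_eLpNorm_restrict measurableSet_Ioo]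
    exact eLpNorm_extensionDeriv_le h0 h1 hp b hvi

/-! ### Reflection and the right-sided case -/

/-- The other direction. -/
def Side.flip : Side → Side
  | Side.left => Side.right
  | Side.right => Side.left

theorem leftRLDeriv_eq_rightRLDeriv_comp_neg (α : ℝ) (φ : ℝ → ℝ) (x : ℝ) :
    leftRLDeriv α φ x = rightRLDeriv α (fun y => φ (-y)) (-x) := by
  have e : (fun t => ∫ y in Ioi t, φ (-y) * (y - t) ^ (-α)) =
      fun t => (fun r => ∫ y in Iio r, φ y * (r - y) ^ (-α)) (-t) := by
    funext t
    have := integral_comp_neg_Ioi t (fun y => φ y * (-t - y) ^ (-α))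
    simp only [sub_neg_eq_add, neg_add_eq_sub, integral_Iic_eq_integral_Iio] at this
    exact this
  rw [leftRLDeriv, rightRLDeriv, e,
    deriv_comp_neg (fun r => ∫ y in Iio r, φ y * (r - y) ^ (-α)), neg_neg]
  ring

theorem dualRLDeriv_flip (s : Side) (α : ℝ) (φ : ℝ → ℝ) (x : ℝ) :
    dualRLDeriv s.flip α φ x = dualRLDeriv s α (fun y => φ (-y)) (-x) := by
  cases s
  · exact leftRLDeriv_eq_rightRLDeriv_comp_neg α φ x
  · simp only [Side.flip, dualRLDeriv, leftRLDeriv_eq_rightRLDeriv_comp_neg, neg_neg]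

theorem IsWeakFracDeriv.comp_neg {s : Side} {α : ℝ} {Ω : Set ℝ} (hΩ : IsOpen Ω) {u v : ℝ → ℝ}
    (h : IsWeakFracDeriv s α Ω u v) :
    IsWeakFracDeriv s.flip α (Neg.neg ⁻¹' Ω) (fun x => u (-x)) (fun x => v (-x)) := by
  have hmp : MeasurePreserving (Neg.neg : ℝ → ℝ) volume volume := Measure.measurePreserving_neg volume
  have hme : MeasurableEmbedding (Neg.neg : ℝ → ℝ) := (MeasurableEquiv.neg ℝ).measurableEmbedding
  refine ⟨(hmp.integrableOn_comp_preimage hme).2 h.integrableOn, ?_, fun φ hφ hc hs => ?_⟩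
  · rw [locallyIntegrableOn_iff (hΩ.preimage continuous_neg).isLocallyClosed]
    intro K hK hKc
    have h2 := (locallyIntegrableOn_iff hΩ.isLocallyClosed).1 h.locallyIntegrableOn
      (Neg.neg '' K) (image_subset_iff.2 hK) (hKc.image continuous_neg)
    rw [← hmp.integrableOn_comp_preimage hme, preimage_image_eq _ neg_injective] at h2
    exact h2
  · have hts : tsupport (fun y => φ (-y)) = Neg.neg ⁻¹' tsupport φ :=
      tsupport_comp_eq_preimage φ (Homeomorph.neg ℝ)
    have e := h.integral_eq (fun y => φ (-y)) (hφ.comp contDiff_neg)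
      (hc.comp_homeomorph (Homeomorph.neg ℝ)) (by
        rw [hts]
        intro x hx
        have := hs hx
        simpa using this)
    rw [← hmp.setIntegral_preimage_emb hme (fun x => v x * φ (-x)),
      ← hmp.setIntegral_preimage_emb hme (fun x => u x * _)] at e
    simpa only [neg_neg, dualRLDeriv_flip] using e

theorem IsWeakFracDeriv.exists_extension {s : Side} {α p q a b : ℝ} (h0 : 0 < α) (h1 : α < 1)
    (hp : 1 ≤ p) (hq : 1 ≤ q) (hqα : 1 / q < 1 - α) (hab : a < b) {u v : ℝ → ℝ}
    (h : IsWeakFracDeriv s α (Ioo a b) u v)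
    (hv : MemLp v (ENNReal.ofReal p) (volume.restrict (Ioo a b)))
    (hu : MemLp u (ENNReal.ofReal q) (volume.restrict (Ioo a b))) :
    ∃ w, IsWeakFracDeriv s α univ ((Ioo a b).indicator u) w ∧
      AEStronglyMeasurable w volume ∧
      eLpNorm w (ENNReal.ofReal p) volume ≤
        extensionBound α p * eLpNorm v (ENNReal.ofReal p) (volume.restrict (Ioo a b)) := by
  cases s with
  | left => exact h.exists_extension_left h0 h1 hp hq hqα hab hv hu
  | right =>
    have hmp : MeasurePreserving (Neg.neg : ℝ → ℝ) volume volume :=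
      Measure.measurePreserving_neg volume
    have hpre : (Neg.neg : ℝ → ℝ) ⁻¹' Ioo a b = Ioo (-b) (-a) := by
      ext x
      simp only [mem_preimage, mem_Ioo]
      constructor <;> rintro ⟨h1, h2⟩ <;> constructor <;> linarith
    have hmpr : MeasurePreserving (Neg.neg : ℝ → ℝ) (volume.restrict (Ioo (-b) (-a)))
        (volume.restrict (Ioo a b)) := hpre ▸ hmp.restrict_preimage measurableSet_Ioo
    have h' := h.comp_neg isOpen_Ioo
    rw [hpre] at h'
    obtain ⟨w, hw, hwm, hwn⟩ := h'.exists_extension_left h0 h1 hp hq hqα (neg_lt_neg hab)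
      (hv.comp_measurePreserving hmpr) (hu.comp_measurePreserving hmpr)
    refine ⟨fun x => w (-x), ?_, hwm.comp_measurePreserving hmp, ?_⟩
    · have h2 := hw.comp_neg isOpen_univ
      rw [preimage_univ] at h2
      convert! h2 using 1
      funext x
      by_cases hx : x ∈ Ioo a b
      · rw [indicator_of_mem hx, indicator_of_mem (mem_Ioo.2 ⟨neg_lt_neg hx.2, neg_lt_neg hx.1⟩),
          neg_neg]
      · rw [indicator_of_notMem hx, indicator_of_notMem
          (fun h3 => hx ⟨neg_lt_neg_iff.1 h3.2, neg_lt_neg_iff.1 h3.1⟩)]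
    · rw [show (fun x => w (-x)) = w ∘ Neg.neg from rfl, eLpNorm_comp_measurePreserving hwm hmp]
      refine hwn.trans (le_of_eq ?_)
      rw [← eLpNorm_comp_measurePreserving hv.aestronglyMeasurable hmpr]
      rfl

/-! ### The extension operator and its norm -/

theorem normLpOn_weakFracDeriv {s : Side} {α p : ℝ} {Ω : Set ℝ} (hΩ : IsOpen Ω) {u v : ℝ → ℝ}
    (h : IsWeakFracDeriv s α Ω u v) :
    normLpOn p Ω (weakFracDeriv s α Ω u) = normLpOn p Ω v := by
  have hex : ∃ v, IsWeakFracDeriv s α Ω u v := ⟨v, h⟩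
  rw [weakFracDeriv, dif_pos hex]
  exact congrArg ENNReal.toReal (eLpNorm_congr_ae (IsWeakFracDeriv.ae_eq hΩ hex.choose_spec h))

theorem isClosed_essSupport (f : ℝ → ℝ) : IsClosed (essSupport f) :=
  (isOpen_sUnion fun _ hU => hU.1).isClosed_compl

theorem essSupport_subset {f : ℝ → ℝ} {K : Set ℝ} (hK : IsClosed K)
    (h : f =ᵐ[volume.restrict Kᶜ] 0) : essSupport f ⊆ K :=
  compl_subset_comm.1 (subset_sUnion_of_mem (⟨hK.isOpen_compl, h⟩ :
    Kᶜ ∈ {U : Set ℝ | IsOpen U ∧ f =ᵐ[volume.restrict U] 0}))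

theorem mainTheorem4 (α p : ℝ) (hα0 : 0 < α) (hα1 : α < 1) (hp : 1 ≤ p) (hαp : α * p < 1)
    (Ω' : Set ℝ) (hΩ'open : IsOpen Ω') (hΩ'conn : IsConnected Ω')
    (hΩ'bdd : Bornology.IsBounded Ω') :
    ∃ C : ℝ, 0 < C ∧
      ∀ (a b μ : ℝ), a < b → closure (Ioo a b) ⊆ Ω' → p / (1 - α * p) < μ →
        ∀ s : Side,
          ∃ E : FracSobolevInterLp s α p μ (Ioo a b) → FracSobolev s α p (univ : Set ℝ),
            ∀ u : FracSobolevInterLp s α p μ (Ioo a b),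
              ((E u).1 : ℝ → ℝ) =ᵐ[volume.restrict (Ioo a b)] (u.1 : ℝ → ℝ) ∧
              (IsCompact (essSupport (E u).1) ∧ essSupport (E u).1 ⊆ Ω') ∧
              fracSobolevNorm s α p univ (E u).1 ≤
                C * (fracSobolevNorm s α p (Ioo a b) u.1 + normLpOn μ (Ioo a b) u.1) := by
  have hp0 : 0 < p := by linarith
  have hA : extensionBound α p ≠ ⊤ := extensionBound_ne_top hα0 hp hαp
  have hA1 : 1 ≤ (extensionBound α p).toReal := by
    rw [← ENNReal.toReal_one]
    exact ENNReal.toReal_mono hA le_self_add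
  refine ⟨(extensionBound α p).toReal, by linarith, fun a b μ hab hcl hμ s => ?_⟩
  have hd : 0 < 1 - α * p := by linarith
  -- The assumption on μ is stronger than what is needed: p/(1 - αp) ≥ 1/(1 - α) is equivalent to p
  -- ≥ 1.
  have hμ0 : 1 / (1 - α) < μ := by
    refine lt_of_le_of_lt ?_ hμ
    rw [div_le_div_iff₀ (by linarith) hd]
    nlinarith
  have hμ1 : 1 ≤ μ := by
    refine le_trans ?_ hμ0.le
    rw [le_div_iff₀ (by linarith)]
    linarith
  have hμα : 1 / μ < 1 - α := by
    rw [div_lt_iff₀ (by linarith)]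
    rwa [div_lt_iff₀ (by linarith), mul_comm] at hμ0
  have hmem : ∀ u : FracSobolevInterLp s α p μ (Ioo a b),
      MemLp ((Ioo a b).indicator (u.1 : ℝ → ℝ)) (ENNReal.ofReal p) (volume.restrict univ) := by
    intro u
    rw [Measure.restrict_univ, memLp_indicator_iff_restrict measurableSet_Ioo]
    exact Lp.memLp u.1
  have hext : ∀ u : FracSobolevInterLp s α p μ (Ioo a b), ∃ w,
      IsWeakFracDeriv s α univ ((hmem u).toLp _ : LpOn p univ) w ∧
      MemLp w (ENNReal.ofReal p) (volume.restrict univ) ∧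
      normLpOn p univ w ≤ (extensionBound α p).toReal *
        normLpOn p (Ioo a b) (weakFracDeriv s α (Ioo a b) u.1) := by
    intro u
    obtain ⟨⟨v, hv, hvp⟩, huμ⟩ := u.2
    obtain ⟨w, hw, hwm, hwn⟩ := hv.exists_extension hα0 hα1 hp hμ1 hμα hab hvp huμ
    have hfin := ENNReal.mul_ne_top hA hvp.eLpNorm_ne_top
    refine ⟨w, hw.congr (hmem u).coeFn_toLp.symm, ?_, ?_⟩
    · rw [Measure.restrict_univ]
      exact ⟨hwm, hwn.trans_lt hfin.lt_top⟩
    · rw [normLpOn_weakFracDeriv isOpen_Ioo hv, normLpOn, normLpOn, ← ENNReal.toReal_mul,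
        Measure.restrict_univ]
      exact ENNReal.toReal_mono hfin hwn
  refine ⟨fun u => ⟨(hmem u).toLp _, (hext u).imp fun w hw => ⟨hw.1, hw.2.1⟩⟩, fun u => ?_⟩
  have hcoe : (((hmem u).toLp _ : LpOn p univ) : ℝ → ℝ) =ᵐ[volume]
      (Ioo a b).indicator (u.1 : ℝ → ℝ) := by
    filter_upwards [(ae_restrict_iff' MeasurableSet.univ).1 (hmem u).coeFn_toLp] with x hx
    exact hx (mem_univ x)
  rw [closure_Ioo hab.ne] at hcl
  have hsupp : essSupport ((hmem u).toLp _ : LpOn p univ) ⊆ Icc a b := by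
    refine essSupport_subset isClosed_Icc ?_
    filter_upwards [ae_restrict_of_ae hcoe, ae_restrict_mem isClosed_Icc.isOpen_compl.measurableSet]
      with x hx hxI
    rw [hx, indicator_of_notMem fun h => hxI (Ioo_subset_Icc_self h)]
    rfl
  refine ⟨?_, ⟨isCompact_Icc.of_isClosed_subset (isClosed_essSupport _) hsupp, hsupp.trans hcl⟩, ?_⟩
  · filter_upwards [ae_restrict_of_ae hcoe, ae_restrict_mem measurableSet_Ioo] with x hx hxI
    rw [hx, indicator_of_mem hxI]
  · obtain ⟨w, hw, -, hwn⟩ := hext u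
    have e1 : normLpOn p univ ((hmem u).toLp _ : LpOn p univ) = normLpOn p (Ioo a b) u.1 := by
      rw [normLpOn, normLpOn, eLpNorm_congr_ae (hmem u).coeFn_toLp, Measure.restrict_univ,
        eLpNorm_indicator_eq_eLpNorm_restrict measurableSet_Ioo]
    simp only [fracSobolevNorm]
    rw [normLpOn_weakFracDeriv isOpen_univ hw, e1]
    set A := (extensionBound α p).toReal
    set x := normLpOn p (Ioo a b) u.1
    set y := normLpOn p (Ioo a b) (weakFracDeriv s α (Ioo a b) u.1)
    have hx : 0 ≤ x := ENNReal.toReal_nonneg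
    have hy : 0 ≤ y := ENNReal.toReal_nonneg
    have hw0 : 0 ≤ normLpOn p univ w := ENNReal.toReal_nonneg
    have hm0 : 0 ≤ normLpOn μ (Ioo a b) u.1 := ENNReal.toReal_nonneg
    -- Since A ≥ 1, the same factor also dominates the unchanged L^p norm of u; the L^μ norm is
    -- merely added at the end.
    calc (x ^ p + normLpOn p univ w ^ p) ^ (1 / p)
        ≤ ((A * x) ^ p + (A * y) ^ p) ^ (1 / p) := by
          gcongr
          exact le_mul_of_one_le_left hx hA1
      _ = A * (x ^ p + y ^ p) ^ (1 / p) := by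
          rw [Real.mul_rpow (by linarith) hx, Real.mul_rpow (by linarith) hy, ← mul_add,
            Real.mul_rpow (by positivity) (by positivity), ← Real.rpow_mul (by linarith),
            mul_one_div_cancel hp0.ne', Real.rpow_one]
      _ ≤ A * ((x ^ p + y ^ p) ^ (1 / p) + normLpOn μ (Ioo a b) u.1) :=
          mul_le_mul_of_nonneg_left (by linarith) (by linarith)

end
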